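/- Let $Q_1(x)=\operatorname{sech}(x)$ and $\mathbf{\Psi}_1(x)=\operatorname{sech}(x)\,\bigl(-e^{-x/2},\,e^{x/2}\bigr)^{T}$, $x\in\mathbb{R}$. There exist constants $C>0$ and $\varepsilon>0$ such that for every $Q\in L^2(\mathbb{R};\mathbb{C})$ with $\|Q-Q_1\|_{L^2}\le\varepsilon$ there exist $k,v\in\mathbb{R}$ (depending on $Q$) such that, with $\eta=(k+iv)/2$, the following hold. 1. The spectral problem $$\partial_x\Psi=\begin{pmatrix}\eta & Q\\ -\overline{Q} & -\eta\end{pmatrix}\Psi \qquad(\ast)$$ has a nonzero solution $\Psi=(\Psi_1,\Psi_2)^T\in H^1(\mathbb{R};\mathbb{C}^2)$ with $$|k-1|+|v|+\|\Psi-\mathbf{\Psi}_1\|_{L^\infty}\le C\,\|Q-Q_1\|_{L^2}.$$ 2. If moreover $Q\in H^3(\mathbb{R})$, then for every nonzero solution $\Psi=(\Psi_1,\Psi_2)^T\in H^1(\mathbb{R};\mathbb{C}^2)$ of $(\ast)$ (with this $\eta$), $|\Psi_1|^2+|\Psi_2|^2\neq 0$ almost everywhere, and the function $$q:=-Q-\frac{2k\,\Psi_1\overline{\Psi_2}}{|\Psi_1|^2+|\Psi_2|^2}$$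 belongs to $H^3(\mathbb{R})$ and satisfies $\|q\|_{L^2}\le C\,\|Q-Q_1\|_{L^2}$. Here derivatives are understood in the weak sense. -/

import Mathlib

open MeasureTheory
open scoped NNReal ENNReal ComplexConjugate ContDiff Matrix

noncomputable section

/-- `g` is the weak derivative of `f` on the real line: both are locally integrable and
`∫ φ' f = - ∫ φ g` for all test functions `φ ∈ C_c^∞(ℝ)`. -/
structure HasWeakDeriv {E : Type*} [NormedAddCommGroup E] [NormedSpace ℝ E]
    (f g : ℝ → E) : Prop where
  locallyIntegrable : LocallyIntegrable f
  locallyIntegrable_deriv : LocallyIntegrable g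
  integral_eq : ∀ φ : ℝ → ℝ, ContDiff ℝ ∞ φ → HasCompactSupport φ →
    ∫ x, deriv φ x • f x = - ∫ x, φ x • g x

/-- `f` belongs to the Sobolev space `H^n(ℝ; E)`: `f` and its weak derivatives up to order `n`
are square integrable. -/
def MemH {E : Type*} [NormedAddCommGroup E] [NormedSpace ℝ E] : ℕ → (ℝ → E) → Prop
  | 0, f => MemLp f 2
  | n + 1, f => MemLp f 2 ∧ ∃ g : ℝ → E, HasWeakDeriv f g ∧ MemH n g

/-- The soliton profile `sech x`, as a complex-valued function. -/
def solitonProfile (x : ℝ) : ℂ := ((Real.cosh x)⁻¹ : ℝ)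

/-- The explicit eigenvector `sech x · (-e^{-x/2}, e^{x/2})` for the potential `sech` and the
eigenvalue `1/2`. -/
def solitonEigenvector (x : ℝ) : Fin 2 → ℂ :=
  solitonProfile x • ![((-Real.exp (-x / 2) : ℝ) : ℂ), ((Real.exp (x / 2) : ℝ) : ℂ)]

/-- The matrix `[[η, Q], [-Q̄, -η]]`. -/
def laxMatrix (η Q : ℂ) : Matrix (Fin 2) (Fin 2) ℂ :=
  !![η, Q; -conj Q, -η]

/-- `Ψ` is an `H¹(ℝ; ℂ²)` eigenvector, i.e. a solution in `H¹` which is not (a.e.) zero, of the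
spectral problem `∂ₓ Ψ = [[η, Q], [-Q̄, -η]] Ψ`. -/
structure IsLaxEigenvector (η : ℂ) (Q : ℝ → ℂ) (Ψ : ℝ → Fin 2 → ℂ) : Prop where
  memH : MemH 1 Ψ
  ne_zero : ¬ Ψ =ᵐ[volume] 0
  eqn : HasWeakDeriv Ψ (fun x => laxMatrix η (Q x) *ᵥ Ψ x)

/-- The Bäcklund transform `q = -Q - 2k Ψ₁ Ψ̄₂ / (|Ψ₁|² + |Ψ₂|²)`. -/
def backlundTransform (k : ℝ) (Q : ℝ → ℂ) (Ψ : ℝ → Fin 2 → ℂ) (x : ℝ) : ℂ :=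
  -Q x - 2 * (k : ℂ) * Ψ x 0 * conj (Ψ x 1) / ((‖Ψ x 0‖ ^ 2 + ‖Ψ x 1‖ ^ 2 : ℝ) : ℂ)

end

/-!
Write `Q = sech + p` with `p` small in `L²`. The soliton eigenvector points along the unit vector
`e = (-cos, sin)`, and with `n = (sin, cos)` it forms a rotating orthonormal frame. A solution of
the spectral problem at `η = 1 / 2 + μ` is sought in the form `Ψ = a • (e + t • n)`. The slope `t`
then solves the Riccati equation `t' = tanh · t - μ sech + N(p, t, μ)`, whose linear part
`t' = tanh · t` has the solution `cosh`, growing at both ends: bounded solutions exist under a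
single solvability condition, which determines `μ`, and are unique. The pair `(t, μ)` is therefore
a fixed point of a contraction built from the corresponding Green operator. An energy identity for
`tanh · |t|²` improves the uniform bound on `t` to `‖t‖₂ = O(‖p‖₂)`, which makes the logarithmic
derivative of `a` an integrable perturbation of that of the soliton amplitude.

The Bäcklund transform sees `Ψ` only through the quotient `Ψ₁ Ψ̄₂ / |Ψ|²`, which depends neither on
`a` nor, by the vanishing of the Wronskian of two square integrable solutions, on the choice of the
eigenvector. It equals `-sech / 2 + O(t)`, so that `q = O(p) + O(μ sech) + O(t)`. The quotient
solves a differential equation whose right-hand side is as regular as `Q`, so it gains one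
derivative over `Q` and `q` inherits the regularity of `Q`.
-/

open Set Filter Topology

section AbsolutelyContinuous

variable {E F : Type*} [NormedAddCommGroup E] [NormedAddCommGroup F] {f g h k : ℝ → E}

theorem absolutelyContinuousOnInterval_of_dist_le {X Y : Type*} [PseudoMetricSpace X]
    [PseudoMetricSpace Y] {f : ℝ → X} {g : ℝ → Y} {a b : ℝ} {K : ℝ≥0}
    (hg : AbsolutelyContinuousOnInterval g a b)
    (hfg : ∀ x ∈ uIcc a b, ∀ y ∈ uIcc a b, dist (f x) (f y) ≤ K * dist (g x) (g y)) :
    AbsolutelyContinuousOnInterval f a b := by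
  rw [absolutelyContinuousOnInterval_iff] at hg ⊢
  intro ε hε
  obtain ⟨δ, hδ, hgδ⟩ := hg (ε / (K + 1)) (by positivity)
  refine ⟨δ, hδ, fun I hI hIδ => ?_⟩
  calc ∑ i ∈ Finset.range I.1, dist (f (I.2 i).1) (f (I.2 i).2)
      ≤ ∑ i ∈ Finset.range I.1, (K + 1) * dist (g (I.2 i).1) (g (I.2 i).2) := by
        refine Finset.sum_le_sum fun i hi => (hfg _ (hI.1 i hi).1 _ (hI.1 i hi).2).trans ?_
        gcongr
        linarith
    _ = (K + 1) * ∑ i ∈ Finset.range I.1, dist (g (I.2 i).1) (g (I.2 i).2) := by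
        rw [Finset.mul_sum]
    _ < (K + 1) * (ε / (K + 1)) := by gcongr; exact hgδ I hI hIδ
    _ = ε := by field_simp

theorem locallyIntegrable_norm {X : Type*} [MeasurableSpace X] [TopologicalSpace X]
    {μ : Measure X} {f : X → E} (hf : LocallyIntegrable f μ) :
    LocallyIntegrable (fun x => ‖f x‖) μ :=
  locallyIntegrableOn_univ.1 (hf.locallyIntegrableOn univ).norm

theorem intervalIntegrable_of_locallyIntegrable (hf : LocallyIntegrable f) (a b : ℝ) :
    IntervalIntegrable f volume a b :=
  (hf.integrableOn_isCompact isCompact_uIcc).intervalIntegrable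

variable [NormedSpace ℝ E] [NormedSpace ℝ F]

/-- `f` is locally absolutely continuous with almost everywhere derivative `g`. This is the form in
which every differential equation below is solved: on the line it is equivalent to
`HasWeakDeriv f g`, up to the choice of the continuous representative of `f`. -/
structure HasACDeriv (f g : ℝ → E) : Prop where
  ac : ∀ a b, AbsolutelyContinuousOnInterval f a b
  locallyIntegrable : LocallyIntegrable g
  hasDerivAt : ∀ᵐ x, HasDerivAt f (g x) x

namespace HasACDeriv

theorem continuous (hf : HasACDeriv f g) : Continuous f := by
  refine continuous_iff_continuousAt.2 fun x => ?_
  refine (hf.ac (x - 1) (x + 1)).continuousOn.continuousAt ?_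
  rw [uIcc_of_le (by linarith)]
  exact Icc_mem_nhds (by linarith) (by linarith)

theorem congr_deriv (hf : HasACDeriv f g) (hgh : g =ᵐ[volume] h) : HasACDeriv f h where
  ac := hf.ac
  locallyIntegrable := hf.locallyIntegrable.congr hgh
  hasDerivAt := by
    filter_upwards [hf.hasDerivAt, hgh] with x hfx hghx
    rwa [← hghx]

theorem of_eq_deriv (hf : HasACDeriv f g) (hgh : ∀ x, g x = h x) : HasACDeriv f h :=
  hf.congr_deriv (.of_forall hgh)

theorem of_hasDerivAt (hf : ∀ x, HasDerivAt f (g x) x) (hg : Continuous g) : HasACDeriv f g where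
  ac a b := by
    refine ContDiffOn.absolutelyContinuousOnInterval (ContDiff.contDiffOn ?_)
    refine contDiff_one_iff_deriv.2 ⟨fun x => (hf x).differentiableAt, ?_⟩
    rwa [funext fun x => (hf x).deriv]
  locallyIntegrable := hg.locallyIntegrable
  hasDerivAt := .of_forall hf

theorem const (c : E) : HasACDeriv (fun _ => c) (fun _ => 0) :=
  of_hasDerivAt (fun x => hasDerivAt_const x c) continuous_const

theorem add (hf : HasACDeriv f g) (hh : HasACDeriv h k) :
    HasACDeriv (fun x => f x + h x) (fun x => g x + k x) where
  ac a b := (hf.ac a b).add (hh.ac a b)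
  locallyIntegrable := hf.locallyIntegrable.add hh.locallyIntegrable
  hasDerivAt := by
    filter_upwards [hf.hasDerivAt, hh.hasDerivAt] with x hfx hhx using hfx.add hhx

theorem neg (hf : HasACDeriv f g) : HasACDeriv (fun x => -f x) (fun x => -g x) where
  ac a b := (hf.ac a b).neg
  locallyIntegrable := hf.locallyIntegrable.neg
  hasDerivAt := by filter_upwards [hf.hasDerivAt] with x hfx using hfx.neg

theorem sub (hf : HasACDeriv f g) (hh : HasACDeriv h k) :
    HasACDeriv (fun x => f x - h x) (fun x => g x - k x) := by
  simpa only [sub_eq_add_neg] using hf.add hh.neg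

theorem comp {φ : E → F} (hf : HasACDeriv f g) (hφ : ∀ x, ContDiffAt ℝ 1 φ (f x)) :
    HasACDeriv (fun x => φ (f x)) (fun x => fderiv ℝ φ (f x) (g x)) where
  ac a b := by
    have hlip : LocallyLipschitzOn (f '' uIcc a b) φ := by
      rintro _ ⟨x, -, rfl⟩
      obtain ⟨K, s, hs, hK⟩ := (hφ x).exists_lipschitzOnWith
      exact ⟨K, s, mem_nhdsWithin_of_mem_nhds hs, hK⟩
    obtain ⟨K, hK⟩ := hlip.exists_lipschitzOnWith_of_compact
      (isCompact_uIcc.image hf.continuous)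
    exact absolutelyContinuousOnInterval_of_dist_le (hf.ac a b) fun x hx y hy =>
      hK.dist_le_mul _ (mem_image_of_mem f hx) _ (mem_image_of_mem f hy)
  locallyIntegrable := by
    have hcont : Continuous fun x => fderiv ℝ φ (f x) := continuous_iff_continuousAt.2 fun x =>
      ((hφ x).fderiv_right (m := 0) (by simp)).continuousAt.comp hf.continuous.continuousAt
    refine ((locallyIntegrable_norm hf.locallyIntegrable).continuous_smul hcont.norm).mono
      ((ContinuousLinearMap.id ℝ (E →L[ℝ] F)).aestronglyMeasurable_comp₂
        hcont.aestronglyMeasurable hf.locallyIntegrable.aestronglyMeasurable)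
      (.of_forall fun x => ?_)
    rw [smul_eq_mul, norm_mul, norm_norm, norm_norm]
    exact (fderiv ℝ φ (f x)).le_opNorm (g x)
  hasDerivAt := by
    filter_upwards [hf.hasDerivAt] with x hfx
    exact ((hφ x).differentiableAt one_ne_zero).hasFDerivAt.comp_hasDerivAt x hfx

theorem clm (L : E →L[ℝ] F) (hf : HasACDeriv f g) :
    HasACDeriv (fun x => L (f x)) (fun x => L (g x)) :=
  (hf.comp fun _ => L.contDiff.contDiffAt).of_eq_deriv fun _ => by rw [L.fderiv]

theorem smul {𝕜 : Type*} [NormedField 𝕜] [NormedAlgebra ℝ 𝕜] [NormedSpace 𝕜 E]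
    [IsScalarTower ℝ 𝕜 E] {u v : ℝ → 𝕜} (hu : HasACDeriv u v) (hf : HasACDeriv f g) :
    HasACDeriv (fun x => u x • f x) (fun x => u x • g x + v x • f x) where
  ac a b := (hu.ac a b).smul (hf.ac a b)
  locallyIntegrable := (hf.locallyIntegrable.continuous_smul hu.continuous).add
    (hu.locallyIntegrable.smul_continuous hf.continuous)
  hasDerivAt := by
    filter_upwards [hu.hasDerivAt, hf.hasDerivAt] with x hux hfx using hux.smul hfx

section NormedField

variable {𝕜 : Type*} [NormedField 𝕜] [NormedAlgebra ℝ 𝕜] {u v p q : ℝ → 𝕜}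

theorem mul (hu : HasACDeriv u v) (hp : HasACDeriv p q) :
    HasACDeriv (fun x => u x * p x) (fun x => v x * p x + u x * q x) :=
  (hu.smul hp).of_eq_deriv fun x => by simp only [smul_eq_mul]; ring

theorem const_mul (c : 𝕜) (hu : HasACDeriv u v) :
    HasACDeriv (fun x => c * u x) (fun x => c * v x) :=
  ((const c).mul hu).of_eq_deriv fun x => by ring

theorem inv (hu : HasACDeriv u v) (hu₀ : ∀ x, u x ≠ 0) :
    HasACDeriv (fun x => (u x)⁻¹) (fun x => -((u x) ^ 2)⁻¹ * v x) :=
  (hu.comp fun x => contDiffAt_inv ℝ (hu₀ x)).of_eq_deriv fun x => by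
    rw [fderiv_inv' (hu₀ x)]
    simp [pow_two, mul_comm, mul_left_comm]

end NormedField

theorem star {u v : ℝ → ℂ} (hu : HasACDeriv u v) :
    HasACDeriv (fun x => conj (u x)) (fun x => conj (v x)) :=
  hu.clm Complex.conjCLE.toContinuousLinearMap

theorem ofReal {u v : ℝ → ℝ} (hu : HasACDeriv u v) :
    HasACDeriv (fun x => (u x : ℂ)) (fun x => (v x : ℂ)) :=
  hu.clm Complex.ofRealCLM

theorem cexp {u v : ℝ → ℂ} (hu : HasACDeriv u v) :
    HasACDeriv (fun x => Complex.exp (u x)) (fun x => Complex.exp (u x) * v x) :=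
  (hu.comp fun _ => Complex.contDiff_exp.contDiffAt).of_eq_deriv fun x => by
    simp [(Complex.hasDerivAt_exp (u x)).complexToReal_fderiv.fderiv]

theorem norm_sq {G : Type*} [NormedAddCommGroup G] [InnerProductSpace ℝ G] {f g : ℝ → G}
    (hf : HasACDeriv f g) :
    HasACDeriv (fun x => ‖f x‖ ^ 2) (fun x => 2 * inner ℝ (f x) (g x)) :=
  (hf.comp fun _ => (contDiff_norm_sq ℝ).contDiffAt).of_eq_deriv fun x => by
    simp

variable [CompleteSpace E]

theorem of_locallyIntegrable (hg : LocallyIntegrable g) (a : ℝ) :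
    HasACDeriv (fun x => ∫ y in a..x, g y) g where
  ac b c := by
    have hnorm : LocallyIntegrable fun x => ‖g x‖ := locallyIntegrable_norm hg
    refine absolutelyContinuousOnInterval_of_dist_le (K := 1)
      ((intervalIntegrable_of_locallyIntegrable hnorm b
        c).absolutelyContinuousOnInterval_intervalIntegral left_mem_uIcc) fun x _ y _ => ?_
    rw [NNReal.coe_one, one_mul, dist_eq_norm, dist_eq_norm,
      intervalIntegral.integral_interval_sub_left
        (intervalIntegrable_of_locallyIntegrable hg _ _)
        (intervalIntegrable_of_locallyIntegrable hg _ _),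
      intervalIntegral.integral_interval_sub_left
        (intervalIntegrable_of_locallyIntegrable hnorm _ _)
        (intervalIntegrable_of_locallyIntegrable hnorm _ _)]
    exact intervalIntegral.norm_integral_le_abs_integral_norm
  locallyIntegrable := hg
  hasDerivAt := by
    filter_upwards [LocallyIntegrable.ae_hasDerivAt_integral hg] with x hx using hx a

theorem integral_eq_sub (hf : HasACDeriv f g) (a b : ℝ) : ∫ x in a..b, g x = f b - f a := by
  have hdiff := hf.sub (of_locallyIntegrable hf.locallyIntegrable a)
  obtain ⟨C, hC⟩ := (hdiff.ac a b).const_of_ae_hasDerivAt_zero (by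
    filter_upwards [hdiff.hasDerivAt] with x hx _
    simpa only [sub_self] using hx)
  have ha := hC a left_mem_uIcc
  have hb := hC b right_mem_uIcc
  simp only [intervalIntegral.integral_same, sub_zero] at ha
  rw [ha, ← hb, sub_sub_cancel]

theorem eq_of_deriv_eq_zero (hf : HasACDeriv f fun _ => 0) (a b : ℝ) : f a = f b := by
  have hab := hf.integral_eq_sub a b
  rw [intervalIntegral.integral_zero] at hab
  exact (sub_eq_zero.1 hab.symm).symm

end HasACDeriv

end AbsolutelyContinuous

section WeakDerivative

theorem exists_tsupport_subset_Ioo {E : Type*} [Zero E] {φ : ℝ → E}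
    (hφ : HasCompactSupport φ) : ∃ R, tsupport φ ⊆ Ioo (-R) R := by
  obtain ⟨R, -, hR⟩ := hφ.isCompact.isBounded.subset_ball_lt 0 0
  exact ⟨R, by simpa only [Real.ball_eq_Ioo, zero_sub, zero_add] using hR⟩

theorem exists_hasCompactSupport_deriv_eq {φ : ℝ → ℝ} (hφ : ContDiff ℝ ∞ φ)
    (hφs : HasCompactSupport φ) (hφ₀ : ∫ x, φ x = 0) :
    ∃ ψ : ℝ → ℝ, ContDiff ℝ ∞ ψ ∧ HasCompactSupport ψ ∧ deriv ψ = φ := by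
  obtain ⟨R, hR⟩ := exists_tsupport_subset_Ioo hφs
  have hsupp : Function.support φ ⊆ Ioo (-R) R := (subset_tsupport φ).trans hR
  have hderiv : ∀ x, HasDerivAt (fun x => ∫ y in -R..x, φ y) (φ x) x := fun x =>
    (hφ.continuous.integral_hasStrictDerivAt (-R) x).hasDerivAt
  have hderiv_eq : deriv (fun x => ∫ y in -R..x, φ y) = φ := funext fun x => (hderiv x).deriv
  refine ⟨fun x => ∫ y in -R..x, φ y, ?_, ?_, hderiv_eq⟩
  · exact contDiff_infty_iff_deriv.2 ⟨fun x => (hderiv x).differentiableAt, by rwa [hderiv_eq]⟩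
  · refine HasCompactSupport.intro (K := Icc (-R) R) isCompact_Icc fun x hx => ?_
    rw [mem_Icc, not_and_or, not_le, not_le] at hx
    rcases hx with hx | hx
    · refine intervalIntegral.integral_zero_ae (.of_forall fun y hy => ?_)
      rw [uIoc_of_ge hx.le] at hy
      exact Function.notMem_support.1 fun hy' => (hsupp hy').1.not_ge hy.2
    · rw [← hφ₀]
      exact intervalIntegral.integral_eq_integral_of_support_subset
        (hsupp.trans ((Ioo_subset_Ioo_right hx.le).trans Ioo_subset_Ioc_self))

variable {E F : Type*} [NormedAddCommGroup E] [NormedSpace ℝ E] [NormedAddCommGroup F]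
  [NormedSpace ℝ F]

theorem HasACDeriv.hasWeakDeriv [CompleteSpace E] {f g : ℝ → E} (hf : HasACDeriv f g) :
    HasWeakDeriv f g where
  locallyIntegrable := hf.continuous.locallyIntegrable
  locallyIntegrable_deriv := hf.locallyIntegrable
  integral_eq φ hφ hφs := by
    have hφ₁ : ContDiff ℝ 1 φ := hφ.of_le (by exact_mod_cast le_top)
    have hφ' : Continuous (deriv φ) := hφ₁.continuous_deriv le_rfl
    have hφAC : HasACDeriv φ (deriv φ) :=
      .of_hasDerivAt (fun x => (hφ₁.differentiable one_ne_zero x).hasDerivAt) hφ'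
    obtain ⟨R, hR⟩ := exists_tsupport_subset_Ioo hφs
    have hsupp : Function.support (fun x => φ x • g x + deriv φ x • f x) ⊆ Ioc (-R) R := by
      refine fun x hx => Ioo_subset_Ioc_self (hR (by_contra fun hxφ => hx ?_))
      have hφx : φ x = 0 := image_eq_zero_of_notMem_tsupport hxφ
      have hφx' : deriv φ x = 0 :=
        Function.notMem_support.1 fun hx' => hxφ (support_deriv_subset hx')
      simp only [hφx, hφx', zero_smul, add_zero]
    have hboundary : ∀ x ∉ Ioo (-R) R, φ x = 0 := fun x hx =>
      image_eq_zero_of_notMem_tsupport fun hxφ => hx (hR hxφ)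
    have hzero : ∫ x, (φ x • g x + deriv φ x • f x) = 0 := by
      rw [← intervalIntegral.integral_eq_integral_of_support_subset hsupp,
        (hφAC.smul hf).integral_eq_sub, hboundary R fun h => lt_irrefl _ h.2,
        hboundary (-R) fun h => lt_irrefl _ h.1, zero_smul, zero_smul, sub_zero]
    rw [integral_add
      (hf.locallyIntegrable.integrable_smul_left_of_hasCompactSupport hφ.continuous hφs)
      (hf.continuous.locallyIntegrable.integrable_smul_left_of_hasCompactSupport hφ'
        hφs.deriv)] at hzero
    exact eq_neg_of_add_eq_zero_right hzero

theorem HasWeakDeriv.congr {f g f' g' : ℝ → E} (hfg : HasWeakDeriv f g)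
    (hf : f =ᵐ[volume] f') (hg : g =ᵐ[volume] g') : HasWeakDeriv f' g' where
  locallyIntegrable := hfg.locallyIntegrable.congr hf
  locallyIntegrable_deriv := hfg.locallyIntegrable_deriv.congr hg
  integral_eq φ hφ hφs := by
    calc ∫ x, deriv φ x • f' x = ∫ x, deriv φ x • f x :=
          integral_congr_ae (by filter_upwards [hf] with x hx; rw [hx])
      _ = -∫ x, φ x • g x := hfg.integral_eq φ hφ hφs
      _ = -∫ x, φ x • g' x := by
          rw [integral_congr_ae]
          filter_upwards [hg] with x hx
          rw [hx]

/-- The du Bois-Reymond lemma: up to a multiple of a fixed bump function, every test function is the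
derivative of a test function. -/
theorem ae_eq_const_of_integral_deriv_smul_eq_zero [CompleteSpace E] {h : ℝ → E}
    (hh : LocallyIntegrable h)
    (h₀ : ∀ φ : ℝ → ℝ, ContDiff ℝ ∞ φ → HasCompactSupport φ → ∫ x, deriv φ x • h x = 0) :
    ∃ c, ∀ᵐ x, h x = c := by
  let bump : ContDiffBump (0 : ℝ) := default
  let χ : ℝ → ℝ := bump.normed volume
  have hχ : ContDiff ℝ ∞ χ := bump.contDiff_normed
  have hχs : HasCompactSupport χ := bump.hasCompactSupport_normed
  have hχ₁ : ∫ x, χ x = 1 := bump.integral_normed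
  refine ⟨∫ x, χ x • h x, ae_eq_of_integral_contDiff_smul_eq hh
    continuous_const.locallyIntegrable fun φ hφ hφs => ?_⟩
  have hφh : Integrable fun x => φ x • h x :=
    hh.integrable_smul_left_of_hasCompactSupport hφ.continuous hφs
  have hχh : Integrable fun x => (∫ y, φ y) • χ x • h x :=
    (hh.integrable_smul_left_of_hasCompactSupport hχ.continuous hχs).smul _
  obtain ⟨ψ, hψ, hψs, hψ'⟩ := exists_hasCompactSupport_deriv_eq
    (φ := fun x => φ x - (∫ y, φ y) * χ x) (hφ.sub (contDiff_const.mul hχ))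
    (hφs.sub hχs.mul_left) (by
      rw [integral_sub (hφ.continuous.integrable_of_hasCompactSupport hφs)
        ((hχ.continuous.integrable_of_hasCompactSupport hχs).const_mul _), integral_const_mul,
        hχ₁, mul_one, sub_self])
  have hψh : ∫ x, (φ x • h x - (∫ y, φ y) • χ x • h x) = 0 := by
    simpa only [hψ', sub_smul, mul_smul] using h₀ ψ hψ hψs
  rw [integral_sub hφh hχh, integral_smul, sub_eq_zero] at hψh
  rw [hψh, integral_smul_const]

theorem HasWeakDeriv.exists_hasACDeriv [CompleteSpace E] {f g : ℝ → E} (hfg : HasWeakDeriv f g) :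
    ∃ F, f =ᵐ[volume] F ∧ HasACDeriv F g := by
  have hG := HasACDeriv.of_locallyIntegrable hfg.locallyIntegrable_deriv 0
  obtain ⟨c, hc⟩ := ae_eq_const_of_integral_deriv_smul_eq_zero
    (hfg.locallyIntegrable.sub hG.hasWeakDeriv.locallyIntegrable) fun φ hφ hφs => by
      have hφ' : Continuous (deriv φ) :=
        (hφ.of_le (m := 1) (by exact_mod_cast le_top)).continuous_deriv le_rfl
      simp only [Pi.sub_apply, smul_sub]
      rw [integral_sub, hfg.integral_eq φ hφ hφs, hG.hasWeakDeriv.integral_eq φ hφ hφs, sub_self]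
      · exact hfg.locallyIntegrable.integrable_smul_left_of_hasCompactSupport hφ' hφs.deriv
      · exact hG.continuous.locallyIntegrable.integrable_smul_left_of_hasCompactSupport hφ'
          hφs.deriv
  refine ⟨fun x => (∫ y in (0 : ℝ)..x, g y) + c, ?_,
    (hG.add (.const c)).of_eq_deriv fun x => add_zero _⟩
  filter_upwards [hc] with x hx
  rw [← hx, Pi.sub_apply, add_sub_cancel]

end WeakDerivative

section Sobolev

variable {E F : Type*} [NormedAddCommGroup E] [NormedSpace ℝ E] [NormedAddCommGroup F]
  [NormedSpace ℝ F] {𝕜 : Type*} [NormedField 𝕜] [NormedAlgebra ℝ 𝕜] [CompleteSpace 𝕜] {n : ℕ}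

theorem HasWeakDeriv.add [CompleteSpace E] {f g f' g' : ℝ → E} (hf : HasWeakDeriv f f')
    (hg : HasWeakDeriv g g') : HasWeakDeriv (fun x => f x + g x) (fun x => f' x + g' x) := by
  obtain ⟨f₀, hff₀, hf₀⟩ := hf.exists_hasACDeriv
  obtain ⟨g₀, hgg₀, hg₀⟩ := hg.exists_hasACDeriv
  refine (hf₀.add hg₀).hasWeakDeriv.congr ?_ (ae_eq_refl _)
  filter_upwards [hff₀, hgg₀] with x hfx hgx
  rw [hfx, hgx]

theorem HasWeakDeriv.clm [CompleteSpace E] [CompleteSpace F] {f f' : ℝ → E} (L : E →L[ℝ] F)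
    (hf : HasWeakDeriv f f') : HasWeakDeriv (fun x => L (f x)) (fun x => L (f' x)) := by
  obtain ⟨f₀, hff₀, hf₀⟩ := hf.exists_hasACDeriv
  refine (hf₀.clm L).hasWeakDeriv.congr ?_ (ae_eq_refl _)
  filter_upwards [hff₀] with x hfx
  rw [hfx]

theorem HasWeakDeriv.mul {f g f' g' : ℝ → 𝕜} (hf : HasWeakDeriv f f') (hg : HasWeakDeriv g g') :
    HasWeakDeriv (fun x => f x * g x) (fun x => f' x * g x + f x * g' x) := by
  obtain ⟨f₀, hff₀, hf₀⟩ := hf.exists_hasACDeriv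
  obtain ⟨g₀, hgg₀, hg₀⟩ := hg.exists_hasACDeriv
  refine (hf₀.mul hg₀).hasWeakDeriv.congr ?_ ?_ <;>
  · filter_upwards [hff₀, hgg₀] with x hfx hgx
    rw [hfx, hgx]

theorem memLp_bounded_mul {α R : Type*} [MeasurableSpace α] {μ : Measure α} [NormedRing R]
    {f g : α → R} {p : ℝ≥0∞} {C : ℝ} (hg : AEStronglyMeasurable g μ) (hC : ∀ᵐ x ∂μ, ‖g x‖ ≤ C)
    (hf : MemLp f p μ) : MemLp (fun x => g x * f x) p μ :=
  hf.mul' (memLp_top_of_bound hg C hC)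

namespace MemH

theorem memLp {f : ℝ → E} (hf : MemH n f) : MemLp f 2 := by
  cases n with
  | zero => exact hf
  | succ n => exact hf.1

theorem of_succ {f : ℝ → E} (hf : MemH (n + 1) f) : MemH n f := by
  induction n generalizing f with
  | zero => exact hf.1
  | succ n ih =>
    obtain ⟨hf₂, f', hf', hf'n⟩ := hf
    exact ⟨hf₂, f', hf', ih hf'n⟩

theorem of_le {f : ℝ → E} {m : ℕ} (hmn : m ≤ n) (hf : MemH n f) : MemH m f := by
  induction n, hmn using Nat.le_induction with
  | base => exact hf
  | succ n _ ih => exact ih hf.of_succ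

theorem congr {f g : ℝ → E} (hf : MemH n f) (hfg : f =ᵐ[volume] g) : MemH n g := by
  cases n with
  | zero => exact MemLp.ae_eq hfg hf
  | succ n =>
    obtain ⟨hf₂, f', hf', hf'n⟩ := hf
    exact ⟨hf₂.ae_eq hfg, f', hf'.congr hfg (ae_eq_refl _), hf'n⟩

theorem add [CompleteSpace E] {f g : ℝ → E} (hf : MemH n f) (hg : MemH n g) :
    MemH n fun x => f x + g x := by
  induction n generalizing f g with
  | zero => exact MemLp.add hf hg
  | succ n ih =>
    obtain ⟨hf₂, f', hf', hf'n⟩ := hf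
    obtain ⟨hg₂, g', hg', hg'n⟩ := hg
    exact ⟨hf₂.add hg₂, _, hf'.add hg', ih hf'n hg'n⟩

theorem clm [CompleteSpace E] [CompleteSpace F] {f : ℝ → E} (L : E →L[ℝ] F) (hf : MemH n f) :
    MemH n fun x => L (f x) := by
  induction n generalizing f with
  | zero => exact MemLp.continuousLinearMap_comp hf L
  | succ n ih =>
    obtain ⟨hf₂, f', hf', hf'n⟩ := hf
    exact ⟨hf₂.continuousLinearMap_comp L, _, hf'.clm L, ih hf'n⟩

theorem const_mul {f : ℝ → 𝕜} (c : 𝕜) (hf : MemH n f) : MemH n fun x => c * f x :=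
  hf.clm (ContinuousLinearMap.mul ℝ 𝕜 c)

theorem star {f : ℝ → ℂ} (hf : MemH n f) : MemH n fun x => conj (f x) :=
  hf.clm Complex.conjCLE.toContinuousLinearMap

theorem exists_bound {f : ℝ → 𝕜} (hf : MemH (n + 1) f) : ∃ C, ∀ᵐ x, ‖f x‖ ≤ C := by
  obtain ⟨hf₂, f', hf', hf'n⟩ := hf
  obtain ⟨f₀, hff₀, hf₀⟩ := hf'.exists_hasACDeriv
  have hf₀₂ : MemLp f₀ 2 := hf₂.ae_eq hff₀
  have hint : Integrable fun x => f' x * f₀ x + f₀ x * f' x :=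
    (hf'n.memLp.integrable_mul hf₀₂).add (hf₀₂.integrable_mul hf'n.memLp)
  refine ⟨√(‖f₀ 0 * f₀ 0‖ + ∫ x, ‖f' x * f₀ x + f₀ x * f' x‖), ?_⟩
  filter_upwards [hff₀] with x hfx
  have hsq : f₀ x * f₀ x = f₀ 0 * f₀ 0 + ∫ y in (0 : ℝ)..x, (f' y * f₀ y + f₀ y * f' y) := by
    rw [(hf₀.mul hf₀).integral_eq_sub 0 x, add_sub_cancel]
  refine Real.le_sqrt_of_sq_le ?_
  rw [hfx, sq, ← norm_mul, hsq]
  refine (norm_add_le _ _).trans ?_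
  gcongr
  exact intervalIntegral.norm_integral_le_integral_norm_uIoc.trans
    (setIntegral_le_integral hint.norm (.of_forall fun x => norm_nonneg _))

/-- The weak derivative of `D f` is `D' f + D f'`, where `D' f` is treated by the induction
hypothesis with the bounded function `f` as multiplier. -/
theorem mul_of_bounded {D D' f : ℝ → 𝕜} {C : ℝ} {m : ℕ} (hD : HasWeakDeriv D D')
    (hC : ∀ᵐ x, ‖D x‖ ≤ C) (hD' : MemH n D') (hmn : m ≤ n + 1) (hf : MemH m f) :
    MemH m fun x => D x * f x := by
  induction m generalizing n D D' f C with
  | zero => exact memLp_bounded_mul hD.locallyIntegrable.aestronglyMeasurable hC hf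
  | succ m ih =>
    obtain ⟨B, hB⟩ := hf.exists_bound
    obtain ⟨hf₂, f', hf', hf'm⟩ := hf
    have hfD' : MemH m fun x => f x * D' x :=
      ih hf' hB hf'm (Nat.le_succ m) (hD'.of_le (Nat.succ_le_succ_iff.1 hmn))
    refine ⟨memLp_bounded_mul hD.locallyIntegrable.aestronglyMeasurable hC hf₂, _, hD.mul hf', ?_⟩
    simpa only [mul_comm (D' _)] using hfD'.add (ih hD hC hD' ((Nat.le_succ m).trans hmn) hf'm)

theorem mul {f g : ℝ → 𝕜} {m : ℕ} (hmn : m ≤ n + 1) (hf : MemH m f) (hg : MemH (n + 1) g) :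
    MemH m fun x => f x * g x := by
  obtain ⟨C, hC⟩ := hg.exists_bound
  obtain ⟨-, g', hg', hg'n⟩ := hg
  simpa only [mul_comm (f _)] using mul_of_bounded hg' hC hg'n hmn hf

end MemH

end Sobolev

section ExponentialKernel

theorem integral_exp_neg_mul_abs_sub {a : ℝ} (ha : 0 < a) (x : ℝ) :
    ∫ y, Real.exp (-a * |x - y|) = 2 / a := by
  rw [integral_sub_left_eq_self (fun y => Real.exp (-a * |y|)) volume x,
    integral_comp_abs (f := fun y => Real.exp (-a * y)),
    integral_exp_mul_Ioi (neg_lt_zero.2 ha)]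
  simp only [mul_zero, Real.exp_zero]
  ring

theorem integrable_exp_neg_mul_abs_sub {a : ℝ} (ha : 0 < a) (x : ℝ) :
    Integrable fun y => Real.exp (-a * |x - y|) :=
  Integrable.of_integral_ne_zero <| by
    rw [integral_exp_neg_mul_abs_sub ha]
    exact (div_pos two_pos ha).ne'

theorem exp_neg_abs_sq (x : ℝ) : Real.exp (-|x|) ^ 2 = Real.exp (-2 * |x|) := by
  rw [← Real.exp_nat_mul]
  push_cast
  ring_nf

theorem memLp_exp_neg_abs_sub (x : ℝ) : MemLp (fun y => Real.exp (-|x - y|)) 2 := by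
  rw [memLp_two_iff_integrable_sq (by fun_prop)]
  simpa only [exp_neg_abs_sq] using integrable_exp_neg_mul_abs_sub two_pos x

theorem integral_mul_le_of_integral_sq_le {X : Type*} [MeasurableSpace X] {μ : Measure X}
    {f g : X → ℝ} {A B : ℝ} (hf : MemLp f 2 μ) (hg : MemLp g 2 μ) (hf₀ : 0 ≤ᵐ[μ] f)
    (hg₀ : 0 ≤ᵐ[μ] g) (hA : 0 ≤ A) (hB : 0 ≤ B) (hfA : ∫ x, f x ^ 2 ∂μ ≤ A ^ 2)
    (hgB : ∫ x, g x ^ 2 ∂μ ≤ B ^ 2) : ∫ x, f x * g x ∂μ ≤ A * B := by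
  have htwo : ENNReal.ofReal 2 = 2 := ENNReal.ofReal_ofNat 2
  have hholder := integral_mul_le_Lp_mul_Lq_of_nonneg Real.HolderConjugate.two_two hf₀ hg₀
    (htwo ▸ hf) (htwo ▸ hg)
  simp only [Real.rpow_two, ← Real.sqrt_eq_rpow] at hholder
  refine hholder.trans ?_
  gcongr
  · exact (Real.sqrt_le_left hA).2 hfA
  · exact (Real.sqrt_le_left hB).2 hgB

variable {E : Type*} [NormedAddCommGroup E] {p : ℝ → E} {δ β : ℝ}

theorem integrable_exp_neg_abs_sub_mul (hp : MemLp p 2) (α β x : ℝ) :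
    Integrable fun y => Real.exp (-|x - y|) * (α + β * ‖p y‖) := by
  have hconst : Integrable fun y => Real.exp (-|x - y|) := by
    simpa only [neg_one_mul] using integrable_exp_neg_mul_abs_sub one_pos x
  have hnorm : Integrable fun y => Real.exp (-|x - y|) * ‖p y‖ :=
    (memLp_exp_neg_abs_sub x).integrable_mul hp.norm
  refine ((hconst.const_mul α).add (hnorm.const_mul β)).congr (.of_forall fun y => ?_)
  simp only [Pi.add_apply]
  ring

theorem integral_exp_neg_abs_sub_mul_le (hp : MemLp p 2) (hδ₀ : 0 ≤ δ)
    (hδ : ∫ x, ‖p x‖ ^ 2 ≤ δ ^ 2) (hβ : 0 ≤ β) (α x : ℝ) :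
    ∫ y, Real.exp (-|x - y|) * (α + β * ‖p y‖) ≤ 2 * α + β * δ := by
  have hconst : ∫ y, Real.exp (-|x - y|) * α = 2 * α := by
    have hexp := integral_exp_neg_mul_abs_sub one_pos x
    simp only [neg_one_mul, div_one] at hexp
    rw [integral_mul_const, hexp]
  have hnorm : ∫ y, Real.exp (-|x - y|) * ‖p y‖ ≤ 1 * δ := by
    refine integral_mul_le_of_integral_sq_le (memLp_exp_neg_abs_sub x) hp.norm
      (.of_forall fun _ => (Real.exp_pos _).le) (.of_forall fun _ => norm_nonneg _) zero_le_one
      hδ₀ (le_of_eq ?_) hδ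
    simp only [exp_neg_abs_sq, integral_exp_neg_mul_abs_sub two_pos]
    norm_num
  calc ∫ y, Real.exp (-|x - y|) * (α + β * ‖p y‖)
      = ∫ y, (Real.exp (-|x - y|) * α + β * (Real.exp (-|x - y|) * ‖p y‖)) := by
        congr 1 with y
        ring
    _ = 2 * α + β * ∫ y, Real.exp (-|x - y|) * ‖p y‖ := by
        rw [integral_add, hconst, integral_const_mul]
        · simpa using integrable_exp_neg_abs_sub_mul hp α 0 x
        · exact ((memLp_exp_neg_abs_sub x).integrable_mul hp.norm).const_mul β
    _ ≤ 2 * α + β * δ := by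
        gcongr
        simpa only [one_mul] using hnorm

end ExponentialKernel

section Sech

/-- The hyperbolic secant, which Mathlib does not define. -/
noncomputable def sech (x : ℝ) : ℝ := (Real.cosh x)⁻¹

theorem sech_pos (x : ℝ) : 0 < sech x := inv_pos.2 (Real.cosh_pos x)

@[fun_prop]
theorem continuous_sech : Continuous sech :=
  Real.continuous_cosh.inv₀ fun x => (Real.cosh_pos x).ne'

theorem sech_le_one (x : ℝ) : sech x ≤ 1 := inv_le_one_of_one_le₀ (Real.one_le_cosh x)

theorem abs_sech_le_one (x : ℝ) : |sech x| ≤ 1 :=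
  (abs_of_pos (sech_pos x)).trans_le (sech_le_one x)

theorem sech_le_two_mul_exp_neg_abs (x : ℝ) : sech x ≤ 2 * Real.exp (-|x|) := by
  rw [sech, inv_le_comm₀ (Real.cosh_pos x) (by positivity), mul_inv, ← Real.exp_neg, neg_neg,
    ← Real.cosh_abs, Real.cosh_eq]
  linarith [Real.exp_pos (-|x|)]

theorem cosh_mul_sech (x : ℝ) : Real.cosh x * sech x = 1 :=
  mul_inv_cancel₀ (Real.cosh_pos x).ne'

theorem sinh_mul_sech (x : ℝ) : Real.sinh x * sech x = Real.tanh x := by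
  rw [Real.tanh_eq_sinh_div_cosh, div_eq_mul_inv, sech]

theorem sech_sq_add_tanh_sq (x : ℝ) : sech x ^ 2 + Real.tanh x ^ 2 = 1 := by
  rw [← sinh_mul_sech]
  linear_combination (Real.cosh x * sech x + 1) * cosh_mul_sech x - sech x ^ 2 * Real.cosh_sq x

theorem exp_neg_mul_one_add_tanh (x : ℝ) : Real.exp (-x) * (1 + Real.tanh x) = sech x := by
  rw [← sinh_mul_sech, ← Real.cosh_sub_sinh]
  linear_combination sech x * Real.cosh_sq x - (Real.cosh x - Real.sinh x) * cosh_mul_sech x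

theorem exp_mul_one_sub_tanh (x : ℝ) : Real.exp x * (1 - Real.tanh x) = sech x := by
  rw [← sinh_mul_sech, ← Real.cosh_add_sinh]
  linear_combination sech x * Real.cosh_sq x - (Real.cosh x + Real.sinh x) * cosh_mul_sech x

theorem hasDerivAt_sech (x : ℝ) : HasDerivAt sech (-(Real.tanh x * sech x)) x := by
  refine ((Real.hasDerivAt_cosh x).inv (Real.cosh_pos x).ne').congr_deriv ?_
  rw [← sinh_mul_sech, sech]
  field_simp

theorem hasDerivAt_tanh (x : ℝ) : HasDerivAt Real.tanh (sech x ^ 2) x := by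
  rw [funext Real.tanh_eq_sinh_div_cosh]
  refine ((Real.hasDerivAt_sinh x).div (Real.hasDerivAt_cosh x)
    (Real.cosh_pos x).ne').congr_deriv ?_
  rw [← sq, ← sq, Real.cosh_sq x, add_sub_cancel_left, sech, inv_pow, ← Real.cosh_sq, one_div]

@[fun_prop]
theorem continuous_tanh : Continuous Real.tanh :=
  continuous_iff_continuousAt.2 fun x => (hasDerivAt_tanh x).continuousAt

theorem sech_sq_le (x : ℝ) : sech x ^ 2 ≤ 4 * Real.exp (-2 * |0 - x|) :=
  calc sech x ^ 2 ≤ (2 * Real.exp (-|x|)) ^ 2 :=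
        pow_le_pow_left₀ (sech_pos x).le (sech_le_two_mul_exp_neg_abs x) 2
    _ = 4 * Real.exp (-2 * |0 - x|) := by rw [mul_pow, exp_neg_abs_sq, zero_sub, abs_neg]; norm_num

theorem memLp_sech : MemLp sech 2 := by
  rw [memLp_two_iff_integrable_sq continuous_sech.aestronglyMeasurable]
  refine ((integrable_exp_neg_mul_abs_sub two_pos 0).const_mul 4).mono'
    (by fun_prop) (ae_of_all _ fun x => ?_)
  rw [Real.norm_of_nonneg (sq_nonneg _)]
  exact sech_sq_le x

theorem integral_sech_sq_le : ∫ x, sech x ^ 2 ≤ 4 :=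
  calc ∫ x, sech x ^ 2 ≤ ∫ x, 4 * Real.exp (-2 * |0 - x|) :=
        integral_mono memLp_sech.integrable_sq
          ((integrable_exp_neg_mul_abs_sub two_pos 0).const_mul 4) sech_sq_le
    _ = 4 := by rw [integral_const_mul, integral_exp_neg_mul_abs_sub two_pos]; norm_num

end Sech

section Green

variable {g h : ℝ → ℂ} {G : ℝ → ℝ} {x : ℝ}

/-- The unique bounded solution `t` of `t' = t tanh x - m sech x + g`, where
`m = greenMean g` is the only constant for which a bounded solution exists. -/
noncomputable def greenOp (g : ℝ → ℂ) (x : ℝ) : ℂ :=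
  (Real.exp (-x) / 2 : ℝ) * (∫ y in Iic x, (sech y : ℂ) * g y) -
    (Real.exp x / 2 : ℝ) * ∫ y in Ioi x, (sech y : ℂ) * g y

/-- The multiplier `m` of the solvability condition `∫ (g - m sech) sech = 0`. -/
noncomputable def greenMean (g : ℝ → ℂ) : ℂ := (1 / 2 : ℂ) * ∫ y, (sech y : ℂ) * g y

theorem norm_sech_mul (y : ℝ) (z : ℂ) : ‖(sech y : ℂ) * z‖ = sech y * ‖z‖ := by
  rw [norm_mul, Complex.norm_real, Real.norm_of_nonneg (sech_pos y).le]

theorem integrable_sech_mul (hG : Integrable fun y => Real.exp (-|y|) * G y)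
    (hg : AEStronglyMeasurable g) (hgG : ∀ y, ‖g y‖ ≤ G y) :
    Integrable fun y => (sech y : ℂ) * g y := by
  refine (hG.const_mul 2).mono'
    ((Complex.continuous_ofReal.comp continuous_sech).aestronglyMeasurable.mul hg)
    (.of_forall fun y => ?_)
  rw [norm_sech_mul, ← mul_assoc]
  gcongr
  · exact sech_le_two_mul_exp_neg_abs y
  · exact hgG y

theorem norm_greenMean_le_integral (hG : Integrable fun y => Real.exp (-|y|) * G y)
    (hgG : ∀ y, ‖g y‖ ≤ G y) : ‖greenMean g‖ ≤ ∫ y, Real.exp (-|y|) * G y := by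
  rw [greenMean, ← integral_const_mul]
  refine norm_integral_le_of_norm_le hG (.of_forall fun y => ?_)
  have hsech : 1 / 2 * sech y ≤ Real.exp (-|y|) := by
    linarith [sech_le_two_mul_exp_neg_abs y]
  rw [norm_mul, norm_sech_mul, ← mul_assoc]
  gcongr
  · simpa using hsech
  · exact hgG y

theorem exp_neg_mul_sech_le {x y : ℝ} (hyx : y ≤ x) :
    Real.exp (-x) / 2 * sech y ≤ Real.exp (-|x - y|) :=
  calc Real.exp (-x) / 2 * sech y ≤ Real.exp (-x) / 2 * (2 * Real.exp (-|y|)) := by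
        gcongr
        exact sech_le_two_mul_exp_neg_abs y
    _ = Real.exp (-x + -|y|) := by rw [Real.exp_add]; ring
    _ ≤ Real.exp (-|x - y|) := by
        rw [abs_of_nonneg (sub_nonneg.2 hyx)]
        exact Real.exp_le_exp.2 (by linarith [neg_abs_le y])

theorem exp_mul_sech_le {x y : ℝ} (hxy : x ≤ y) :
    Real.exp x / 2 * sech y ≤ Real.exp (-|x - y|) := by
  have hreflect := exp_neg_mul_sech_le (neg_le_neg hxy)
  rwa [neg_neg, sech, Real.cosh_neg, ← sech, neg_sub_neg, abs_sub_comm] at hreflect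

theorem norm_greenOp_le_integral (hG : Integrable fun y => Real.exp (-|x - y|) * G y)
    (hgG : ∀ y, ‖g y‖ ≤ G y) : ‖greenOp g x‖ ≤ ∫ y, Real.exp (-|x - y|) * G y := by
  have hhalf : ∀ {s : Set ℝ} {c : ℝ}, MeasurableSet s → 0 ≤ c →
      (∀ y ∈ s, c * sech y ≤ Real.exp (-|x - y|)) →
      ‖(c : ℂ) * ∫ y in s, (sech y : ℂ) * g y‖ ≤ ∫ y in s, Real.exp (-|x - y|) * G y := by
    intro s c hs hc hcs
    rw [← integral_const_mul]
    refine norm_integral_le_of_norm_le hG.integrableOn ?_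
    filter_upwards [ae_restrict_mem hs] with y hy
    rw [norm_mul, norm_sech_mul, Complex.norm_real, Real.norm_of_nonneg hc, ← mul_assoc]
    gcongr
    · exact hcs y hy
    · exact hgG y
  rw [← intervalIntegral.integral_Iic_add_Ioi (b := x) hG.integrableOn hG.integrableOn]
  refine (norm_sub_le _ _).trans (add_le_add ?_ ?_)
  · exact hhalf measurableSet_Iic (by positivity) fun y hy => exp_neg_mul_sech_le hy
  · exact hhalf measurableSet_Ioi (by positivity) fun y hy => exp_mul_sech_le (mem_Ioi.1 hy).le

theorem greenOp_sub (hg : Integrable fun y => (sech y : ℂ) * g y)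
    (hh : Integrable fun y => (sech y : ℂ) * h y) (x : ℝ) :
    greenOp (fun y => g y - h y) x = greenOp g x - greenOp h x := by
  simp only [greenOp, mul_sub]
  rw [integral_sub hg.integrableOn hh.integrableOn, integral_sub hg.integrableOn hh.integrableOn]
  ring

theorem greenMean_sub (hg : Integrable fun y => (sech y : ℂ) * g y)
    (hh : Integrable fun y => (sech y : ℂ) * h y) :
    greenMean (fun y => g y - h y) = greenMean g - greenMean h := by
  simp only [greenMean, mul_sub]
  rw [integral_sub hg hh]
  ring

theorem hasACDeriv_integral_Iic {E : Type*} [NormedAddCommGroup E] [NormedSpace ℝ E]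
    [CompleteSpace E] {g : ℝ → E} (hg : Integrable g) :
    HasACDeriv (fun x => ∫ y in Iic x, g y) g := by
  have hsplit : (fun x => ∫ y in Iic x, g y) =
      fun x => (∫ y in Iic 0, g y) + ∫ y in (0 : ℝ)..x, g y := by
    funext x
    rw [← intervalIntegral.integral_Iic_sub_Iic hg.integrableOn hg.integrableOn, add_sub_cancel]
  rw [hsplit]
  exact ((HasACDeriv.const _).add (.of_locallyIntegrable hg.locallyIntegrable 0)).of_eq_deriv
    fun x => zero_add _

theorem hasACDeriv_integral_Ioi {E : Type*} [NormedAddCommGroup E] [NormedSpace ℝ E]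
    [CompleteSpace E] {g : ℝ → E} (hg : Integrable g) :
    HasACDeriv (fun x => ∫ y in Ioi x, g y) fun x => -g x := by
  have hsplit : (fun x => ∫ y in Ioi x, g y) = fun x => (∫ y, g y) - ∫ y in Iic x, g y := by
    funext x
    rw [← intervalIntegral.integral_Iic_add_Ioi (b := x) hg.integrableOn hg.integrableOn,
      add_sub_cancel_left]
  rw [hsplit]
  exact ((HasACDeriv.const _).sub (hasACDeriv_integral_Iic hg)).of_eq_deriv fun x => zero_sub _

theorem hasACDeriv_greenOp (hg : Integrable fun y => (sech y : ℂ) * g y) :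
    HasACDeriv (greenOp g) fun x =>
      (Real.tanh x : ℂ) * greenOp g x - greenMean g * sech x + g x := by
  have hexp : HasACDeriv (fun x : ℝ => ((Real.exp x / 2 : ℝ) : ℂ))
      (fun x : ℝ => ((Real.exp x / 2 : ℝ) : ℂ)) :=
    (HasACDeriv.of_hasDerivAt (fun x => (Real.hasDerivAt_exp x).div_const 2) (by fun_prop)).ofReal
  have hexp_neg : HasACDeriv (fun x : ℝ => ((Real.exp (-x) / 2 : ℝ) : ℂ))
      (fun x : ℝ => ((-Real.exp (-x) / 2 : ℝ) : ℂ)) :=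
    (HasACDeriv.of_hasDerivAt (fun x => by
      simpa using ((hasDerivAt_neg x).exp).div_const 2) (by fun_prop)).ofReal
  refine ((hexp_neg.mul (hasACDeriv_integral_Iic hg)).sub
    (hexp.mul (hasACDeriv_integral_Ioi hg))).of_eq_deriv fun x => ?_
  have hone : ((Real.exp x + Real.exp (-x)) * sech x : ℂ) = 2 := by
    have hcosh := cosh_mul_sech x
    rw [Real.cosh_eq] at hcosh
    exact_mod_cast (by linarith : (Real.exp x + Real.exp (-x)) * sech x = 2)
  have hleft : (Real.exp (-x) * (1 + Real.tanh x) : ℂ) = sech x := by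
    exact_mod_cast exp_neg_mul_one_add_tanh x
  have hright : (Real.exp x * (1 - Real.tanh x) : ℂ) = sech x := by
    exact_mod_cast exp_mul_one_sub_tanh x
  simp only [greenOp, greenMean]
  rw [← intervalIntegral.integral_Iic_add_Ioi (b := x) hg.integrableOn hg.integrableOn]
  push_cast at hone hleft hright ⊢
  linear_combination g x / 2 * hone - (∫ y in Iic x, (sech y : ℂ) * g y) / 2 * hleft -
    (∫ y in Ioi x, (sech y : ℂ) * g y) / 2 * hright

end Green

open scoped BoundedContinuousFunction

section Riccati

theorem norm_greenMean_le {E : Type*} [NormedAddCommGroup E] {p : ℝ → E} {g : ℝ → ℂ} {δ α β : ℝ}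
    (hp : MemLp p 2) (hδ₀ : 0 ≤ δ) (hδ : ∫ x, ‖p x‖ ^ 2 ≤ δ ^ 2) (hβ : 0 ≤ β)
    (hgp : ∀ y, ‖g y‖ ≤ α + β * ‖p y‖) : ‖greenMean g‖ ≤ 2 * α + β * δ := by
  have hint := integrable_exp_neg_abs_sub_mul hp α β 0
  have hle := integral_exp_neg_abs_sub_mul_le hp hδ₀ hδ hβ α 0
  simp only [zero_sub, abs_neg] at hint hle
  exact (norm_greenMean_le_integral hint hgp).trans hle

theorem norm_greenOp_le {E : Type*} [NormedAddCommGroup E] {p : ℝ → E} {g : ℝ → ℂ} {δ α β : ℝ}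
    (hp : MemLp p 2) (hδ₀ : 0 ≤ δ) (hδ : ∫ x, ‖p x‖ ^ 2 ≤ δ ^ 2) (hβ : 0 ≤ β)
    (hgp : ∀ y, ‖g y‖ ≤ α + β * ‖p y‖) (x : ℝ) : ‖greenOp g x‖ ≤ 2 * α + β * δ :=
  (norm_greenOp_le_integral (integrable_exp_neg_abs_sub_mul hp α β x) hgp).trans
    (integral_exp_neg_abs_sub_mul_le hp hδ₀ hδ hβ α x)

/-- The complex number `Re p + i T Im p`. For `T = ± tanh x` these are the off-diagonal entries, up
to sign, of the matrix `[[0, p], [-p̄, 0]]` in the orthonormal frame `(-cos, sin)`, `(sin, cos)`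
whose first vector points along the soliton eigenvector at `x`. -/
noncomputable def imScale (T : ℝ) (p : ℂ) : ℂ := p.re + T * p.im * Complex.I

/-- The nonlinearity of the Riccati equation for the slope `t` of the perturbed eigenvector relative
to the soliton eigenvector. Here `p` is the perturbation of the potential, `μ` that of the
eigenvalue, and `S`, `T` stand for `sech x`, `tanh x`. -/
noncomputable def riccatiTerm (S T : ℝ) (p t μ : ℂ) : ℂ :=
  imScale T p + t * (2 * μ * T + 2 * p.im * Complex.I * S) +
    t ^ 2 * ((1 + μ) * S + imScale (-T) p)

section Pointwise

variable {S T : ℝ} {p t t' μ μ' : ℂ}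

theorem norm_imScale_le (hT : |T| ≤ 1) : ‖imScale T p‖ ≤ ‖p‖ := by
  have him : |T * p.im| ≤ |p.im| := by
    rw [abs_mul]
    exact mul_le_of_le_one_left (abs_nonneg _) hT
  rw [imScale, ← Complex.ofReal_mul, Complex.norm_add_mul_I, Complex.norm_def,
    Complex.normSq_apply, ← sq, ← sq]
  exact Real.sqrt_le_sqrt (by linarith [sq_le_sq.2 him])

theorem norm_im_mul_I_le : ‖(p.im * Complex.I : ℂ)‖ ≤ ‖p‖ := by
  simpa using Complex.abs_im_le_norm p

theorem norm_mul_ofReal_le (z : ℂ) (hT : |T| ≤ 1) : ‖z * T‖ ≤ ‖z‖ := by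
  rw [norm_mul, Complex.norm_real, Real.norm_eq_abs]
  exact mul_le_of_le_one_right (norm_nonneg z) hT

theorem norm_riccati_linear_coeff_le (hS : |S| ≤ 1) (hT : |T| ≤ 1) :
    ‖2 * μ * T + 2 * p.im * Complex.I * S‖ ≤ 2 * ‖μ‖ + 2 * ‖p‖ := by
  refine (norm_add_le _ _).trans (add_le_add ?_ ?_)
  · exact (norm_mul_ofReal_le _ hT).trans (by rw [norm_mul, Complex.norm_two])
  · refine (norm_mul_ofReal_le _ hS).trans ?_
    rw [mul_assoc, norm_mul, Complex.norm_two]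
    gcongr
    exact norm_im_mul_I_le

theorem norm_riccati_quadratic_coeff_le (hS : |S| ≤ 1) (hT : |T| ≤ 1) :
    ‖(1 + μ) * S + imScale (-T) p‖ ≤ 1 + ‖μ‖ + ‖p‖ := by
  refine (norm_add_le _ _).trans (add_le_add ?_ (norm_imScale_le (by rwa [abs_neg])))
  exact (norm_mul_ofReal_le _ hS).trans ((norm_add_le _ _).trans (by rw [norm_one]))

theorem norm_riccatiTerm_le (hS : |S| ≤ 1) (hT : |T| ≤ 1) :
    ‖riccatiTerm S T p t μ‖ ≤ (2 * ‖t‖ * ‖μ‖ + ‖t‖ ^ 2 * (1 + ‖μ‖)) +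
      (1 + 2 * ‖t‖ + ‖t‖ ^ 2) * ‖p‖ :=
  calc ‖riccatiTerm S T p t μ‖
      ≤ ‖p‖ + ‖t‖ * (2 * ‖μ‖ + 2 * ‖p‖) + ‖t‖ ^ 2 * (1 + ‖μ‖ + ‖p‖) := by
        refine norm_add₃_le.trans ?_
        rw [norm_mul, norm_mul, norm_pow]
        gcongr
        · exact norm_imScale_le hT
        · exact norm_riccati_linear_coeff_le hS hT
        · exact norm_riccati_quadratic_coeff_le hS hT
    _ = _ := by ring

theorem norm_riccatiTerm_sub_le (hS : |S| ≤ 1) (hT : |T| ≤ 1) {R d : ℝ} (hR : R ≤ 1)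
    (ht : ‖t‖ ≤ R) (hμ : ‖μ‖ ≤ R) (ht' : ‖t'‖ ≤ R) (htt' : ‖t - t'‖ ≤ d) (hμμ' : ‖μ - μ'‖ ≤ d) :
    ‖riccatiTerm S T p t μ - riccatiTerm S T p t' μ'‖ ≤ 9 * R * d + 4 * d * ‖p‖ := by
  have hR₀ : 0 ≤ R := (norm_nonneg _).trans ht
  have hd₀ : 0 ≤ d := (norm_nonneg _).trans htt'
  have hsum : ‖t + t'‖ ≤ 2 * R := (norm_add_le _ _).trans (by linarith)
  have hslope : ‖2 * μ * T + 2 * p.im * Complex.I * S +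
      (t + t') * ((1 + μ) * S + imScale (-T) p)‖ ≤ 6 * R + 4 * ‖p‖ :=
    calc _ ≤ 2 * ‖μ‖ + 2 * ‖p‖ + ‖t + t'‖ * (1 + ‖μ‖ + ‖p‖) := by
          refine (norm_add_le _ _).trans ?_
          rw [norm_mul]
          gcongr
          · exact norm_riccati_linear_coeff_le hS hT
          · exact norm_riccati_quadratic_coeff_le hS hT
      _ ≤ 2 * R + 2 * ‖p‖ + 2 * R * (1 + 1 + ‖p‖) := by gcongr; exact hμ.trans hR
      _ ≤ 6 * R + 4 * ‖p‖ := by nlinarith [norm_nonneg p]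
  have hshift : ‖2 * t' * T + t' ^ 2 * S‖ ≤ 3 * R :=
    calc _ ≤ 2 * ‖t'‖ + ‖t'‖ ^ 2 := by
          refine (norm_add_le _ _).trans (add_le_add ?_ ?_)
          · exact (norm_mul_ofReal_le _ hT).trans (by rw [norm_mul, Complex.norm_two])
          · exact (norm_mul_ofReal_le _ hS).trans (by rw [norm_pow])
      _ ≤ 2 * R + R ^ 2 := by gcongr
      _ ≤ 3 * R := by nlinarith
  calc ‖riccatiTerm S T p t μ - riccatiTerm S T p t' μ'‖
      = ‖(t - t') * (2 * μ * T + 2 * p.im * Complex.I * S +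
          (t + t') * ((1 + μ) * S + imScale (-T) p)) +
          (μ - μ') * (2 * t' * T + t' ^ 2 * S)‖ := by
        congr 1
        simp only [riccatiTerm]
        ring
    _ ≤ d * (6 * R + 4 * ‖p‖) + d * (3 * R) := by
        refine (norm_add_le _ _).trans ?_
        rw [norm_mul, norm_mul]
        gcongr
    _ = 9 * R * d + 4 * d * ‖p‖ := by ring

end Pointwise

/-- The nonlinearity of the Riccati equation along the functions `p` and `t`. -/
noncomputable def riccatiSource (p t : ℝ → ℂ) (μ : ℂ) (x : ℝ) : ℂ :=
  riccatiTerm (sech x) (Real.tanh x) (p x) (t x) μ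

variable {p t : ℝ → ℂ} {μ : ℂ} {δ : ℝ}

theorem aestronglyMeasurable_riccatiSource (hp : AEStronglyMeasurable p) (ht : Continuous t)
    (μ : ℂ) : AEStronglyMeasurable (riccatiSource p t μ) := by
  have hcont : Continuous fun z : ℝ × ℂ =>
      riccatiTerm (sech z.1) (Real.tanh z.1) z.2 (t z.1) μ := by
    unfold riccatiTerm imScale
    fun_prop
  have hpair : AEStronglyMeasurable fun x => (x, p x) := aestronglyMeasurable_id.prodMk hp
  exact (hcont.comp_aestronglyMeasurable hpair :)

theorem norm_riccatiSource_le (x : ℝ) :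
    ‖riccatiSource p t μ x‖ ≤ (2 * ‖t x‖ * ‖μ‖ + ‖t x‖ ^ 2 * (1 + ‖μ‖)) +
      (1 + 2 * ‖t x‖ + ‖t x‖ ^ 2) * ‖p x‖ :=
  norm_riccatiTerm_le (abs_sech_le_one x) (Real.abs_tanh_lt_one x).le

theorem norm_riccatiSource_le_of_le {T : ℝ} (ht : ∀ x, ‖t x‖ ≤ T) (x : ℝ) :
    ‖riccatiSource p t μ x‖ ≤ (2 * T * ‖μ‖ + T ^ 2 * (1 + ‖μ‖)) +
      (1 + 2 * T + T ^ 2) * ‖p x‖ := by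
  refine (norm_riccatiSource_le x).trans ?_
  gcongr <;> exact ht x

theorem integrable_sech_mul_riccatiSource {T : ℝ} (hp : MemLp p 2) (ht : Continuous t)
    (htT : ∀ x, ‖t x‖ ≤ T) (μ : ℂ) : Integrable fun x => (sech x : ℂ) * riccatiSource p t μ x :=
  integrable_sech_mul
    (by simpa only [zero_sub, abs_neg] using integrable_exp_neg_abs_sub_mul hp _ _ 0)
    (aestronglyMeasurable_riccatiSource hp.1 ht μ) (norm_riccatiSource_le_of_le htT)

/-- The map whose fixed points `(t, μ)` are the bounded solutions of the Riccati equation, the Green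
operator being applied to its nonlinearity. -/
noncomputable def riccatiMap (hp : MemLp p 2) (u : (ℝ →ᵇ ℂ) × ℂ) : (ℝ →ᵇ ℂ) × ℂ :=
  (BoundedContinuousFunction.ofNormedAddCommGroup (greenOp (riccatiSource p u.1 u.2))
    (hasACDeriv_greenOp (integrable_sech_mul_riccatiSource hp u.1.continuous
      u.1.norm_coe_le_norm u.2)).continuous _
    (norm_greenOp_le hp (Real.sqrt_nonneg _)
      (Real.sq_sqrt (integral_nonneg fun _ => sq_nonneg _)).ge (by positivity)
      (norm_riccatiSource_le_of_le u.1.norm_coe_le_norm)),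
    greenMean (riccatiSource p u.1 u.2))

theorem norm_riccatiMap_le (hp : MemLp p 2) (hδ₀ : 0 ≤ δ) (hδ₁ : δ ≤ 1 / 200)
    (hδ : ∫ x, ‖p x‖ ^ 2 ≤ δ ^ 2) {u : (ℝ →ᵇ ℂ) × ℂ} (hu : ‖u‖ ≤ 2 * δ) :
    ‖riccatiMap hp u‖ ≤ 2 * δ := by
  obtain ⟨ht, hμ⟩ : ‖u.1‖ ≤ 2 * δ ∧ ‖u.2‖ ≤ 2 * δ := norm_prod_le_iff.1 hu
  have hsource : ∀ y, ‖riccatiSource p u.1 u.2 y‖ ≤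
      (2 * (2 * δ) * (2 * δ) + (2 * δ) ^ 2 * (1 + 2 * δ)) +
        (1 + 2 * (2 * δ) + (2 * δ) ^ 2) * ‖p y‖ := fun y => by
    refine (norm_riccatiSource_le_of_le (fun x => (u.1.norm_coe_le_norm x).trans ht) y).trans ?_
    gcongr
  have hbound : 2 * (2 * (2 * δ) * (2 * δ) + (2 * δ) ^ 2 * (1 + 2 * δ)) +
      (1 + 2 * (2 * δ) + (2 * δ) ^ 2) * δ ≤ 2 * δ := by
    nlinarith [mul_nonneg hδ₀ hδ₀, mul_nonneg hδ₀ (mul_nonneg hδ₀ (sub_nonneg.2 hδ₁)),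
      mul_nonneg hδ₀ (sub_nonneg.2 hδ₁)]
  refine norm_prod_le_iff.2
    ⟨(BoundedContinuousFunction.norm_le (by positivity)).2 fun x => ?_, ?_⟩
  · exact (norm_greenOp_le hp hδ₀ hδ (by positivity) hsource x).trans hbound
  · exact (norm_greenMean_le hp hδ₀ hδ (by positivity) hsource).trans hbound

theorem norm_riccatiMap_sub_le (hp : MemLp p 2) (hδ₀ : 0 ≤ δ) (hδ₁ : δ ≤ 1 / 200)
    (hδ : ∫ x, ‖p x‖ ^ 2 ≤ δ ^ 2) {u v : (ℝ →ᵇ ℂ) × ℂ} (hu : ‖u‖ ≤ 2 * δ) (hv : ‖v‖ ≤ 2 * δ) :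
    ‖riccatiMap hp u - riccatiMap hp v‖ ≤ 1 / 2 * ‖u - v‖ := by
  obtain ⟨hut, huμ⟩ : ‖u.1‖ ≤ 2 * δ ∧ ‖u.2‖ ≤ 2 * δ := norm_prod_le_iff.1 hu
  have hvt : ‖v.1‖ ≤ 2 * δ := (norm_prod_le_iff.1 hv).1
  have hsource : ∀ y, ‖riccatiSource p u.1 u.2 y - riccatiSource p v.1 v.2 y‖ ≤
      9 * (2 * δ) * ‖u - v‖ + 4 * ‖u - v‖ * ‖p y‖ := fun y =>
    norm_riccatiTerm_sub_le (abs_sech_le_one y) (Real.abs_tanh_lt_one y).le (by linarith)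
      ((u.1.norm_coe_le_norm y).trans hut) huμ ((v.1.norm_coe_le_norm y).trans hvt)
      (((u.1 - v.1).norm_coe_le_norm y).trans (norm_fst_le (u - v))) (norm_snd_le (u - v))
  have hbound : 2 * (9 * (2 * δ) * ‖u - v‖) + 4 * ‖u - v‖ * δ ≤ 1 / 2 * ‖u - v‖ := by
    nlinarith [norm_nonneg (u - v)]
  have hint : ∀ w : (ℝ →ᵇ ℂ) × ℂ, Integrable fun y => (sech y : ℂ) * riccatiSource p w.1 w.2 y :=
    fun w => integrable_sech_mul_riccatiSource hp w.1.continuous w.1.norm_coe_le_norm w.2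
  refine norm_prod_le_iff.2
    ⟨(BoundedContinuousFunction.norm_le (by positivity)).2 fun x => ?_, ?_⟩
  · change ‖greenOp (riccatiSource p u.1 u.2) x - greenOp (riccatiSource p v.1 v.2) x‖ ≤ _
    rw [← greenOp_sub (hint u) (hint v)]
    exact (norm_greenOp_le hp hδ₀ hδ (by positivity) hsource x).trans hbound
  · change ‖greenMean (riccatiSource p u.1 u.2) - greenMean (riccatiSource p v.1 v.2)‖ ≤ _
    rw [← greenMean_sub (hint u) (hint v)]
    exact (norm_greenMean_le hp hδ₀ hδ (by positivity) hsource).trans hbound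

theorem exists_fixedPoint_of_norm_sub_le {E : Type*} [NormedAddCommGroup E] [CompleteSpace E]
    {Φ : E → E} {r : ℝ} {K : ℝ≥0} (hr : 0 ≤ r) (hK : K < 1) (hmaps : ∀ u, ‖u‖ ≤ r → ‖Φ u‖ ≤ r)
    (hlip : ∀ u v, ‖u‖ ≤ r → ‖v‖ ≤ r → ‖Φ u - Φ v‖ ≤ K * ‖u - v‖) : ∃ u, ‖u‖ ≤ r ∧ Φ u = u := by
  have hmapsTo : MapsTo Φ (Metric.closedBall 0 r) (Metric.closedBall 0 r) := fun u hu =>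
    mem_closedBall_zero_iff.2 (hmaps u (mem_closedBall_zero_iff.1 hu))
  have hcontr : ContractingWith K (hmapsTo.restrict Φ _ _) :=
    ⟨hK, LipschitzWith.of_dist_le_mul fun u v => by
      simpa only [Subtype.dist_eq, MapsTo.val_restrict_apply, dist_eq_norm] using
        hlip u v (mem_closedBall_zero_iff.1 u.2) (mem_closedBall_zero_iff.1 v.2)⟩
  obtain ⟨u, hu, hfix, -⟩ := hcontr.exists_fixedPoint' Metric.isClosed_closedBall.isComplete
    hmapsTo (x := 0) (Metric.mem_closedBall_self hr) (edist_ne_top _ _)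
  exact ⟨u, mem_closedBall_zero_iff.1 hu, hfix⟩

/-- `(t, μ)` is a solution of size `O(δ)` of the Riccati equation for a potential `sech + p` with
`‖p‖_{L²} ≤ δ ≤ 1/200`. Then `1/2 + μ` is an eigenvalue for that potential, with eigenvector
pointing along `(-cos, sin) + t (sin, cos)`. -/
structure IsSmallRiccatiSolution (p : ℝ → ℂ) (δ : ℝ) (t : ℝ → ℂ) (μ : ℂ) : Prop where
  memLp : MemLp p 2
  nonneg : 0 ≤ δ
  le : δ ≤ 1 / 200
  integral_norm_sq_le : ∫ x, ‖p x‖ ^ 2 ≤ δ ^ 2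
  norm_le : ∀ x, ‖t x‖ ≤ 2 * δ
  norm_eigenvalue_le : ‖μ‖ ≤ 2 * δ
  hasACDeriv : HasACDeriv t fun x =>
    (Real.tanh x : ℂ) * t x - μ * sech x + riccatiSource p t μ x

theorem exists_isSmallRiccatiSolution (hp : MemLp p 2) (hδ₀ : 0 ≤ δ) (hδ₁ : δ ≤ 1 / 200)
    (hδ : ∫ x, ‖p x‖ ^ 2 ≤ δ ^ 2) : ∃ t μ, IsSmallRiccatiSolution p δ t μ := by
  obtain ⟨u, hu, hfix⟩ := exists_fixedPoint_of_norm_sub_le (Φ := riccatiMap hp) (r := 2 * δ)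
    (K := 1 / 2) (by positivity) (by norm_num) (fun u hu => norm_riccatiMap_le hp hδ₀ hδ₁ hδ hu)
    fun u v hu hv => by
      push_cast
      exact norm_riccatiMap_sub_le hp hδ₀ hδ₁ hδ hu hv
  obtain ⟨hut, huμ⟩ := norm_prod_le_iff.1 hu
  have hslope : greenOp (riccatiSource p u.1 u.2) = u.1 :=
    congrArg (fun w : (ℝ →ᵇ ℂ) × ℂ => (w.1 : ℝ → ℂ)) hfix
  have heigenvalue : greenMean (riccatiSource p u.1 u.2) = u.2 := congrArg Prod.snd hfix
  have hode := hasACDeriv_greenOp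
    (integrable_sech_mul_riccatiSource hp u.1.continuous u.1.norm_coe_le_norm u.2)
  rw [hslope, heigenvalue] at hode
  exact ⟨u.1, u.2, hp, hδ₀, hδ₁, hδ, fun x => (u.1.norm_coe_le_norm x).trans hut, huμ, hode⟩

end Riccati

section Energy

theorem integrable_and_integral_le_of_le_deriv_add {f F F' M : ℝ → ℝ} {B : ℝ} (hf : Continuous f)
    (hf₀ : ∀ x, 0 ≤ f x) (hF : HasACDeriv F F') (hB : ∀ x, |F x| ≤ B) (hM : Integrable M)
    (hM₀ : ∀ x, 0 ≤ M x) (hle : ∀ x, f x ≤ F' x + M x) :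
    Integrable f ∧ ∫ x, f x ≤ 2 * B + ∫ x, M x := by
  have hbound : ∀ n : ℕ, ∫ x in (-(n : ℝ))..n, f x ≤ 2 * B + ∫ x, M x := fun n => by
    have hn : -(n : ℝ) ≤ n := by linarith [n.cast_nonneg (α := ℝ)]
    have hF'int := intervalIntegrable_of_locallyIntegrable hF.locallyIntegrable (-(n : ℝ)) n
    have hMint : IntervalIntegrable M volume (-(n : ℝ)) n := hM.intervalIntegrable
    calc ∫ x in (-(n : ℝ))..n, f x ≤ ∫ x in (-(n : ℝ))..n, F' x + M x :=
          intervalIntegral.integral_mono_on hn (hf.intervalIntegrable _ _) (hF'int.add hMint)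
            fun x _ => hle x
      _ = F n - F (-n) + ∫ x in (-(n : ℝ))..n, M x := by
          rw [intervalIntegral.integral_add hF'int hMint, hF.integral_eq_sub]
      _ ≤ 2 * B + ∫ x, M x := by
          refine add_le_add ?_ ?_
          · linarith [abs_le.1 (hB n), abs_le.1 (hB (-n))]
          · rw [intervalIntegral.integral_of_le hn]
            exact setIntegral_le_integral hM (ae_of_all _ hM₀)
  have hbot : Tendsto (fun n : ℕ => -(n : ℝ)) atTop atBot :=
    tendsto_neg_atTop_atBot.comp tendsto_natCast_atTop_atTop
  have hint : Integrable f :=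
    integrable_of_intervalIntegral_norm_bounded _ (fun n => (hf.integrableOn_Ioc : _)) hbot
      tendsto_natCast_atTop_atTop (Eventually.of_forall fun n => by
        simpa only [Real.norm_of_nonneg (hf₀ _)] using hbound n)
  exact ⟨hint, le_of_tendsto' (intervalIntegral_tendsto_integral hint hbot
    tendsto_natCast_atTop_atTop) hbound⟩

/- `S² ‖t‖² + T ⟪t, ·⟫` is the derivative of the energy `T ‖t‖²` when `T = tanh`, `T' = S²`. -/
theorem norm_sq_le_add_norm_sq {E : Type*} [NormedAddCommGroup E] [InnerProductSpace ℝ E] {S T : ℝ}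
    (hST : S ^ 2 + T ^ 2 = 1) (t g : E) :
    ‖t‖ ^ 2 ≤ S ^ 2 * ‖t‖ ^ 2 + T * (2 * inner ℝ t (T • t + g)) + ‖g‖ ^ 2 := by
  have hsq : 0 ≤ ‖T • t + g‖ ^ 2 := sq_nonneg _
  rw [norm_add_sq_real, norm_smul, Real.norm_eq_abs, mul_pow, sq_abs, real_inner_smul_left] at hsq
  rw [inner_add_right, real_inner_smul_right, real_inner_self_eq_norm_sq]
  linear_combination hsq - ‖t‖ ^ 2 * hST

variable {p t : ℝ → ℂ} {μ : ℂ} {δ : ℝ}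

namespace IsSmallRiccatiSolution

theorem norm_sq_forcing_le (h : IsSmallRiccatiSolution p δ t μ) (x : ℝ) :
    ‖riccatiSource p t μ x - μ * sech x‖ ^ 2 ≤
      ‖t x‖ ^ 2 / 2 + 12 * δ ^ 2 * sech x ^ 2 + 12 * ‖p x‖ ^ 2 := by
  have ht : ‖t x‖ ≤ 1 / 100 := (h.norm_le x).trans (by linarith [h.le])
  have hμ : ‖μ‖ ≤ 1 / 100 := h.norm_eigenvalue_le.trans (by linarith [h.le])
  have hsource : ‖riccatiSource p t μ x‖ ≤ ‖t x‖ / 16 + 2 * ‖p x‖ :=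
    calc _ ≤ (2 * ‖t x‖ * ‖μ‖ + ‖t x‖ * ‖t x‖ * (1 + ‖μ‖)) +
            (1 + 2 * ‖t x‖ + ‖t x‖ ^ 2) * ‖p x‖ := (norm_riccatiSource_le x).trans (by rw [sq])
      _ ≤ (2 * ‖t x‖ * (1 / 100) + ‖t x‖ * (1 / 100) * (1 + 1 / 100)) +
            (1 + 2 * (1 / 100) + (1 / 100) ^ 2) * ‖p x‖ := by gcongr
      _ ≤ ‖t x‖ / 16 + 2 * ‖p x‖ := by linarith [norm_nonneg (t x), norm_nonneg (p x)]
  have hsech : ‖μ * sech x‖ ≤ 2 * δ * sech x := by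
    rw [mul_comm, norm_sech_mul, mul_comm]
    exact mul_le_mul_of_nonneg_right h.norm_eigenvalue_le (sech_pos x).le
  calc _ ≤ (‖t x‖ / 16 + 2 * ‖p x‖ + 2 * δ * sech x) ^ 2 := by
        gcongr
        exact (norm_sub_le _ _).trans (add_le_add hsource hsech)
    _ ≤ _ := by
        nlinarith [sq_nonneg (‖t x‖ / 16 - 2 * ‖p x‖), sq_nonneg (‖t x‖ / 16 - 2 * δ * sech x),
          sq_nonneg (2 * ‖p x‖ - 2 * δ * sech x), sq_nonneg ‖t x‖]

theorem integrable_and_integral_le (h : IsSmallRiccatiSolution p δ t μ) :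
    (Integrable fun x => ‖t x‖ ^ 2) ∧ ∫ x, ‖t x‖ ^ 2 ≤ 136 * δ ^ 2 := by
  have henergy := (HasACDeriv.of_hasDerivAt (fun x => (hasDerivAt_tanh x).const_mul 2)
    (by fun_prop)).mul h.hasACDeriv.norm_sq
  have hpsq : Integrable fun x => ‖p x‖ ^ 2 := h.memLp.integrable_norm_pow two_ne_zero
  have hM : Integrable fun x => 24 * δ ^ 2 * sech x ^ 2 + 24 * ‖p x‖ ^ 2 :=
    (memLp_sech.integrable_sq.const_mul _).add (hpsq.const_mul _)
  have hB : ∀ x, |2 * Real.tanh x * ‖t x‖ ^ 2| ≤ 8 * δ ^ 2 := fun x => by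
    rw [abs_mul, abs_mul, abs_two, abs_of_nonneg (sq_nonneg ‖t x‖)]
    calc 2 * |Real.tanh x| * ‖t x‖ ^ 2 ≤ 2 * 1 * (2 * δ) ^ 2 := by
          gcongr
          exacts [(Real.abs_tanh_lt_one x).le, h.norm_le x]
      _ = 8 * δ ^ 2 := by ring
  have hle : ∀ x, ‖t x‖ ^ 2 ≤ 2 * sech x ^ 2 * ‖t x‖ ^ 2 + 2 * Real.tanh x * (2 * inner ℝ (t x)
      ((Real.tanh x : ℂ) * t x - μ * sech x + riccatiSource p t μ x)) +
      (24 * δ ^ 2 * sech x ^ 2 + 24 * ‖p x‖ ^ 2) := fun x => by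
    have hforcing := h.norm_sq_forcing_le x
    have hpoint := norm_sq_le_add_norm_sq (sech_sq_add_tanh_sq x) (t x)
      (riccatiSource p t μ x - μ * sech x)
    rw [Complex.real_smul, ← add_sub_assoc, add_sub_right_comm] at hpoint
    linarith
  obtain ⟨hint, hintle⟩ := integrable_and_integral_le_of_le_deriv_add
    (h.hasACDeriv.continuous.norm.pow 2) (fun x => sq_nonneg _) henergy hB hM
    (fun x => by positivity) hle
  refine ⟨hint, hintle.trans ?_⟩
  rw [integral_add (memLp_sech.integrable_sq.const_mul _) (hpsq.const_mul _),
    integral_const_mul, integral_const_mul]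
  nlinarith [h.integral_norm_sq_le, integral_sech_sq_le, sq_nonneg δ]

end IsSmallRiccatiSolution

end Energy

section Frame

/-- Half the norm of the soliton eigenvector. -/
noncomputable def sechRoot (x : ℝ) : ℝ := √(sech x / 2)

/-- The cosine of the angle of the soliton eigenvector, which turns by `π / 2` from `-∞` to `∞`. -/
noncomputable def frameCos (x : ℝ) : ℝ := Real.exp (-x / 2) * sechRoot x

/-- The sine of the angle of the soliton eigenvector. -/
noncomputable def frameSin (x : ℝ) : ℝ := Real.exp (x / 2) * sechRoot x

theorem sq_sechRoot (x : ℝ) : sechRoot x ^ 2 = sech x / 2 :=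
  Real.sq_sqrt (half_pos (sech_pos x)).le

theorem sechRoot_pos (x : ℝ) : 0 < sechRoot x := Real.sqrt_pos.2 (half_pos (sech_pos x))

theorem sechRoot_le (x : ℝ) : sechRoot x ≤ Real.exp (-|x| / 2) := by
  refine Real.sqrt_le_iff.2 ⟨(Real.exp_pos _).le, ?_⟩
  rw [← Real.exp_nat_mul, Nat.cast_ofNat, mul_div_cancel₀ _ two_ne_zero]
  linarith [sech_le_two_mul_exp_neg_abs x]

theorem hasDerivAt_sechRoot (x : ℝ) :
    HasDerivAt sechRoot (-(Real.tanh x / 2) * sechRoot x) x := by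
  refine (((hasDerivAt_sech x).div_const 2).sqrt (half_pos (sech_pos x)).ne').congr_deriv ?_
  change -(Real.tanh x * sech x) / 2 / (2 * sechRoot x) = _
  rw [div_eq_iff (mul_pos two_pos (sechRoot_pos x)).ne']
  linear_combination Real.tanh x * sq_sechRoot x

theorem sq_frameCos (x : ℝ) : frameCos x ^ 2 = (1 - Real.tanh x) / 2 := by
  rw [frameCos, mul_pow, sq_sechRoot, ← exp_mul_one_sub_tanh, ← Real.exp_nat_mul, Nat.cast_ofNat,
    mul_div_cancel₀ _ two_ne_zero, mul_div_assoc, ← mul_assoc, ← Real.exp_add, neg_add_cancel,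
    Real.exp_zero, one_mul]

theorem sq_frameSin (x : ℝ) : frameSin x ^ 2 = (1 + Real.tanh x) / 2 := by
  rw [frameSin, mul_pow, sq_sechRoot, ← exp_neg_mul_one_add_tanh, ← Real.exp_nat_mul,
    Nat.cast_ofNat, mul_div_cancel₀ _ two_ne_zero, mul_div_assoc, ← mul_assoc, ← Real.exp_add,
    add_neg_cancel, Real.exp_zero, one_mul]

theorem frameCos_mul_frameSin (x : ℝ) : frameCos x * frameSin x = sech x / 2 := by
  rw [frameCos, frameSin, mul_mul_mul_comm, ← Real.exp_add, ← sq, sq_sechRoot, neg_div,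
    neg_add_cancel, Real.exp_zero, one_mul]

theorem frameCos_sq_add_frameSin_sq (x : ℝ) : frameCos x ^ 2 + frameSin x ^ 2 = 1 := by
  rw [sq_frameCos, sq_frameSin]
  ring

theorem abs_frameCos_le_one (x : ℝ) : |frameCos x| ≤ 1 :=
  (sq_le_one_iff_abs_le_one _).1 (by nlinarith [frameCos_sq_add_frameSin_sq x])

theorem abs_frameSin_le_one (x : ℝ) : |frameSin x| ≤ 1 :=
  (sq_le_one_iff_abs_le_one _).1 (by nlinarith [frameCos_sq_add_frameSin_sq x])

theorem hasDerivAt_frameCos (x : ℝ) : HasDerivAt frameCos (-(sech x / 2) * frameSin x) x := by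
  refine ((((hasDerivAt_neg x).div_const 2).exp).mul (hasDerivAt_sechRoot x)).congr_deriv ?_
  calc _ = -((1 + Real.tanh x) / 2) * frameCos x := by rw [frameCos]; ring
    _ = -(sech x / 2) * frameSin x := by rw [← sq_frameSin, ← frameCos_mul_frameSin]; ring

theorem hasDerivAt_frameSin (x : ℝ) : HasDerivAt frameSin (sech x / 2 * frameCos x) x := by
  refine ((((hasDerivAt_id' x).div_const 2).exp).mul (hasDerivAt_sechRoot x)).congr_deriv ?_
  calc _ = (1 - Real.tanh x) / 2 * frameSin x := by rw [frameSin]; ring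
    _ = sech x / 2 * frameCos x := by rw [← sq_frameCos, ← frameCos_mul_frameSin]; ring

/-- The unit vector `(-cos, sin)` along the soliton eigenvector. -/
noncomputable def solitonDirection (x : ℝ) : Fin 2 → ℂ := ![-(frameCos x : ℂ), frameSin x]

/-- The unit vector `(sin, cos)` orthogonal to the soliton eigenvector. -/
noncomputable def solitonNormal (x : ℝ) : Fin 2 → ℂ := ![(frameSin x : ℂ), frameCos x]

theorem solitonEigenvector_eq_smul (x : ℝ) :
    solitonEigenvector x = (2 * sechRoot x : ℂ) • solitonDirection x := by
  have hprofile : solitonProfile x = 2 * sechRoot x * sechRoot x := by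
    have hsech : sech x = 2 * sechRoot x * sechRoot x := by linear_combination -2 * sq_sechRoot x
    exact (congrArg Complex.ofReal hsech).trans (by push_cast; rfl)
  ext i
  fin_cases i <;>
    simp [solitonEigenvector, solitonDirection, hprofile, frameCos, frameSin] <;> ring

theorem norm_solitonDirection_le (x : ℝ) : ‖solitonDirection x‖ ≤ 1 := by
  simp [pi_norm_le_iff_of_nonneg, Fin.forall_fin_two, solitonDirection, abs_frameCos_le_one,
    abs_frameSin_le_one]

theorem norm_solitonNormal_le (x : ℝ) : ‖solitonNormal x‖ ≤ 1 := by
  simp [pi_norm_le_iff_of_nonneg, Fin.forall_fin_two, solitonNormal, abs_frameCos_le_one,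
    abs_frameSin_le_one]

theorem hasDerivAt_solitonDirection (x : ℝ) :
    HasDerivAt solitonDirection ((sech x / 2 : ℂ) • solitonNormal x) x := by
  refine hasDerivAt_pi.2 (Fin.forall_fin_two.2 ⟨?_, ?_⟩)
  · refine (hasDerivAt_frameCos x).ofReal_comp.neg.congr_deriv ?_
    simp [solitonNormal]
  · refine (hasDerivAt_frameSin x).ofReal_comp.congr_deriv ?_
    simp [solitonNormal]

theorem hasDerivAt_solitonNormal (x : ℝ) :
    HasDerivAt solitonNormal (-(sech x / 2 : ℂ) • solitonDirection x) x := by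
  refine hasDerivAt_pi.2 (Fin.forall_fin_two.2 ⟨?_, ?_⟩)
  · refine (hasDerivAt_frameSin x).ofReal_comp.congr_deriv ?_
    simp [solitonDirection]
  · refine (hasDerivAt_frameCos x).ofReal_comp.congr_deriv ?_
    simp [solitonDirection]

theorem hasACDeriv_solitonDirection :
    HasACDeriv solitonDirection fun x => (sech x / 2 : ℂ) • solitonNormal x :=
  .of_hasDerivAt hasDerivAt_solitonDirection (by
    have hcont : Continuous solitonNormal :=
      continuous_iff_continuousAt.2 fun x => (hasDerivAt_solitonNormal x).continuousAt
    fun_prop)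

theorem hasACDeriv_solitonNormal :
    HasACDeriv solitonNormal fun x => -(sech x / 2 : ℂ) • solitonDirection x :=
  .of_hasDerivAt hasDerivAt_solitonNormal (by
    have hcont : Continuous solitonDirection :=
      continuous_iff_continuousAt.2 fun x => (hasDerivAt_solitonDirection x).continuousAt
    fun_prop)

section Lax

variable (η p : ℂ) (x : ℝ)

theorem ofReal_tanh_eq : (Real.tanh x : ℂ) = (frameSin x : ℂ) ^ 2 - (frameCos x : ℂ) ^ 2 := by
  exact_mod_cast (by linarith [sq_frameSin x, sq_frameCos x] :
    Real.tanh x = frameSin x ^ 2 - frameCos x ^ 2)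

theorem ofReal_sech_eq : (sech x : ℂ) = 2 * (frameCos x * frameSin x) := by
  exact_mod_cast (by linarith [frameCos_mul_frameSin x] : sech x = 2 * (frameCos x * frameSin x))

theorem laxMatrix_mulVec_zero (η Q : ℂ) (v : Fin 2 → ℂ) :
    (laxMatrix η Q *ᵥ v) 0 = η * v 0 + Q * v 1 := by
  simp [laxMatrix, Matrix.mulVec, dotProduct]

theorem laxMatrix_mulVec_one (η Q : ℂ) (v : Fin 2 → ℂ) :
    (laxMatrix η Q *ᵥ v) 1 = -conj Q * v 0 - η * v 1 := by
  simp [laxMatrix, Matrix.mulVec, dotProduct, sub_eq_add_neg]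

theorem laxMatrix_mulVec_solitonDirection :
    laxMatrix η (sech x + p) *ᵥ solitonDirection x =
      -(η * Real.tanh x + p.im * Complex.I * sech x) • solitonDirection x +
        ((1 - η) * sech x + imScale (Real.tanh x) p) • solitonNormal x := by
  have hunit : (frameCos x : ℂ) ^ 2 + (frameSin x : ℂ) ^ 2 = 1 := by
    exact_mod_cast frameCos_sq_add_frameSin_sq x
  have hp := Complex.re_add_im p
  have hconj : conj p = p.re - p.im * Complex.I := Complex.ext (by simp) (by simp)
  refine funext (Fin.forall_fin_two.2 ⟨?_, ?_⟩) <;>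
    simp only [laxMatrix_mulVec_zero, laxMatrix_mulVec_one, map_add, map_mul, map_ofNat,
      Complex.conj_ofReal, solitonDirection, solitonNormal, imScale, ofReal_tanh_eq,
      ofReal_sech_eq, Pi.add_apply, Pi.smul_apply, smul_eq_mul,
      Matrix.cons_val_zero, Matrix.cons_val_one] <;>
    grind

theorem laxMatrix_mulVec_solitonNormal :
    laxMatrix η (sech x + p) *ᵥ solitonNormal x =
      -((1 + η) * sech x + imScale (-Real.tanh x) p) • solitonDirection x +
        (η * Real.tanh x + p.im * Complex.I * sech x) • solitonNormal x := by
  have hunit : (frameCos x : ℂ) ^ 2 + (frameSin x : ℂ) ^ 2 = 1 := by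
    exact_mod_cast frameCos_sq_add_frameSin_sq x
  have hp := Complex.re_add_im p
  have hconj : conj p = p.re - p.im * Complex.I := Complex.ext (by simp) (by simp)
  refine funext (Fin.forall_fin_two.2 ⟨?_, ?_⟩) <;>
    simp only [laxMatrix_mulVec_zero, laxMatrix_mulVec_one, map_add, map_mul, map_ofNat,
      Complex.conj_ofReal, solitonDirection, solitonNormal, imScale, Complex.ofReal_neg,
      ofReal_tanh_eq, ofReal_sech_eq, Pi.add_apply, Pi.smul_apply, smul_eq_mul,
      Matrix.cons_val_zero, Matrix.cons_val_one] <;>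
    grind

end Lax

end Frame

section LaxSystem

/-- The quotient `v₁ v̄₂ / |v|²`, through which the Bäcklund transform sees the eigenvector. -/
noncomputable def crossRatio (v : Fin 2 → ℂ) : ℂ := v 0 * conj (v 1) * (v ⬝ᵥ star v)⁻¹

/-- The quotient `(|v₁|² - |v₂|²) / |v|²`, which together with `crossRatio` satisfies a closed
system of differential equations along a solution of the spectral problem. -/
noncomputable def diffRatio (v : Fin 2 → ℂ) : ℂ :=
  (v 0 * conj (v 0) - v 1 * conj (v 1)) * (v ⬝ᵥ star v)⁻¹

theorem dotProduct_star_eq (v w : Fin 2 → ℂ) :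
    v ⬝ᵥ star w = v 0 * conj (w 0) + v 1 * conj (w 1) :=
  Matrix.vec2_dotProduct v (star w)

theorem dotProduct_star_self_eq (v : Fin 2 → ℂ) :
    v ⬝ᵥ star v = ((‖v 0‖ ^ 2 + ‖v 1‖ ^ 2 : ℝ) : ℂ) := by
  rw [dotProduct_star_eq, Complex.mul_conj', Complex.mul_conj']
  push_cast
  rfl

theorem dotProduct_star_self_ne_zero {v : Fin 2 → ℂ} (hv : v ≠ 0) : v ⬝ᵥ star v ≠ 0 := by
  open scoped ComplexOrder in exact mt dotProduct_self_star_eq_zero.1 hv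

theorem norm_diffRatio_le (v : Fin 2 → ℂ) : ‖diffRatio v‖ ≤ 1 := by
  rw [diffRatio, dotProduct_star_self_eq, ← div_eq_mul_inv, norm_div,
    Complex.norm_real, Real.norm_of_nonneg (by positivity)]
  refine div_le_one_of_le₀ ((norm_sub_le _ _).trans ?_) (by positivity)
  rw [norm_mul, norm_mul, RCLike.norm_conj, RCLike.norm_conj, sq, sq]

theorem crossRatio_smul {l : ℂ} (hl : l ≠ 0) (v : Fin 2 → ℂ) :
    crossRatio (l • v) = crossRatio v := by
  have hl' : conj l ≠ 0 := (map_ne_zero _).2 hl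
  calc crossRatio (l • v)
      = l * v 0 * (conj l * conj (v 1)) * (l * (conj l * (v ⬝ᵥ star v)))⁻¹ := by
        rw [crossRatio, star_smul, smul_dotProduct, dotProduct_smul]
        simp
    _ = crossRatio v := by
        rw [crossRatio, mul_inv, mul_inv]
        field_simp

theorem backlundTransform_eq (k : ℝ) (Q : ℝ → ℂ) (Ψ : ℝ → Fin 2 → ℂ) (x : ℝ) :
    backlundTransform k Q Ψ x = -1 * Q x + -(2 * k) * crossRatio (Ψ x) := by
  rw [backlundTransform, crossRatio, dotProduct_star_self_eq]
  ring

/-- `Ψ` is a locally absolutely continuous solution of the spectral problem. -/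
def IsLaxSolution (η : ℂ) (Q : ℝ → ℂ) (Ψ : ℝ → Fin 2 → ℂ) : Prop :=
  HasACDeriv Ψ fun x => laxMatrix η (Q x) *ᵥ Ψ x

variable {η : ℂ} {Q : ℝ → ℂ} {Φ Ψ : ℝ → Fin 2 → ℂ}

theorem IsLaxEigenvector.exists_isLaxSolution (h : IsLaxEigenvector η Q Φ) :
    ∃ Ψ, Φ =ᵐ[volume] Ψ ∧ IsLaxSolution η Q Ψ ∧ MemLp Ψ 2 := by
  obtain ⟨Ψ, hΦΨ, hΨ⟩ := h.eqn.exists_hasACDeriv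
  exact ⟨Ψ, hΦΨ, hΨ.congr_deriv (by filter_upwards [hΦΨ] with x hx; rw [hx]),
    h.memH.memLp.ae_eq hΦΨ⟩

namespace IsLaxSolution

theorem hasACDeriv_fst (h : IsLaxSolution η Q Ψ) :
    HasACDeriv (fun x => Ψ x 0) fun x => η * Ψ x 0 + Q x * Ψ x 1 :=
  (h.clm (ContinuousLinearMap.proj (R := ℝ) (0 : Fin 2))).of_eq_deriv fun x =>
    laxMatrix_mulVec_zero η (Q x) (Ψ x)

theorem hasACDeriv_snd (h : IsLaxSolution η Q Ψ) :
    HasACDeriv (fun x => Ψ x 1) fun x => -conj (Q x) * Ψ x 0 - η * Ψ x 1 :=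
  (h.clm (ContinuousLinearMap.proj (R := ℝ) (1 : Fin 2))).of_eq_deriv fun x =>
    laxMatrix_mulVec_one η (Q x) (Ψ x)

theorem wronskian_eq_zero (hΦ : IsLaxSolution η Q Φ) (hΨ : IsLaxSolution η Q Ψ)
    (hΦ₂ : MemLp Φ 2) (hΨ₂ : MemLp Ψ 2) (x : ℝ) : Φ x 0 * Ψ x 1 - Φ x 1 * Ψ x 0 = 0 := by
  have hW : HasACDeriv (fun x => Φ x 0 * Ψ x 1 - Φ x 1 * Ψ x 0) fun _ => 0 :=
    ((hΦ.hasACDeriv_fst.mul hΨ.hasACDeriv_snd).sub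
      (hΦ.hasACDeriv_snd.mul hΨ.hasACDeriv_fst)).of_eq_deriv fun x => by ring
  have hint : Integrable fun x => Φ x 0 * Ψ x 1 - Φ x 1 * Ψ x 0 :=
    ((hΦ₂.eval 0).integrable_mul (hΨ₂.eval 1)).sub ((hΦ₂.eval 1).integrable_mul (hΨ₂.eval 0))
  rw [funext fun y => hW.eq_of_deriv_eq_zero y x, integrable_const_iff] at hint
  exact hint.resolve_right fun hfin => by simpa using hfin.measure_univ_lt_top

theorem hasACDeriv_dotProduct_star (hΦ : IsLaxSolution η Q Φ) (hΨ : IsLaxSolution η Q Ψ) :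
    HasACDeriv (fun x => Φ x ⬝ᵥ star (Ψ x)) fun x =>
      (η + conj η) * (Φ x 0 * conj (Ψ x 0) - Φ x 1 * conj (Ψ x 1)) := by
  simp only [dotProduct_star_eq]
  refine ((hΦ.hasACDeriv_fst.mul hΨ.hasACDeriv_fst.star).add
    (hΦ.hasACDeriv_snd.mul hΨ.hasACDeriv_snd.star)).of_eq_deriv fun x => ?_
  simp only [map_add, map_sub, map_mul, map_neg, Complex.conj_conj]
  ring

theorem exists_eq_smul (hΦ : IsLaxSolution η Q Φ) (hΨ : IsLaxSolution η Q Ψ) (hΦ₂ : MemLp Φ 2)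
    (hΨ₂ : MemLp Ψ 2) (hΨ₀ : ∀ x, Ψ x ≠ 0) : ∃ l : ℂ, ∀ x, Φ x = l • Ψ x := by
  have hnormSq := fun x => dotProduct_star_self_ne_zero (hΨ₀ x)
  have hratio : HasACDeriv (fun x => (Φ x ⬝ᵥ star (Ψ x)) * (Ψ x ⬝ᵥ star (Ψ x))⁻¹) fun _ => 0 :=
    ((hΦ.hasACDeriv_dotProduct_star hΨ).mul
      ((hΨ.hasACDeriv_dotProduct_star hΨ).inv hnormSq)).of_eq_deriv fun x => by
        have hx := hnormSq x
        have hW := hΦ.wronskian_eq_zero hΨ hΦ₂ hΨ₂ x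
        field_simp
        rw [dotProduct_star_eq, dotProduct_star_eq]
        linear_combination 2 * (η + conj η) * conj (Ψ x 0) * conj (Ψ x 1) * hW
  refine ⟨(Φ 0 ⬝ᵥ star (Ψ 0)) * (Ψ 0 ⬝ᵥ star (Ψ 0))⁻¹, fun x => ?_⟩
  rw [hratio.eq_of_deriv_eq_zero 0 x, ← div_eq_mul_inv]
  have hx := hnormSq x
  have hW := hΦ.wronskian_eq_zero hΨ hΦ₂ hΨ₂ x
  refine funext (Fin.forall_fin_two.2 ⟨?_, ?_⟩) <;>
    rw [Pi.smul_apply, smul_eq_mul, div_mul_eq_mul_div, eq_div_iff hx, dotProduct_star_eq,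
      dotProduct_star_eq]
  · linear_combination conj (Ψ x 1) * hW
  · linear_combination -conj (Ψ x 0) * hW

theorem hasACDeriv_crossRatio (h : IsLaxSolution η Q Ψ) (hΨ₀ : ∀ x, Ψ x ≠ 0) :
    HasACDeriv (fun x => crossRatio (Ψ x)) fun x => (η - conj η) * crossRatio (Ψ x) +
      -1 * (diffRatio (Ψ x) * (Q x + (η + conj η) * crossRatio (Ψ x))) := by
  refine ((h.hasACDeriv_fst.mul h.hasACDeriv_snd.star).mul ((h.hasACDeriv_dotProduct_star h).inv
    fun x => dotProduct_star_self_ne_zero (hΨ₀ x))).of_eq_deriv fun x => ?_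
  have hx := dotProduct_star_self_ne_zero (hΨ₀ x)
  simp only [crossRatio, diffRatio, map_sub, map_mul, map_neg, Complex.conj_conj]
  field_simp
  rw [dotProduct_star_eq]
  ring

theorem hasACDeriv_diffRatio (h : IsLaxSolution η Q Ψ) (hΨ₀ : ∀ x, Ψ x ≠ 0) :
    HasACDeriv (fun x => diffRatio (Ψ x)) fun x =>
      2 * (conj (crossRatio (Ψ x)) * (Q x + (η + conj η) * crossRatio (Ψ x)) +
        crossRatio (Ψ x) * conj (Q x + (η + conj η) * crossRatio (Ψ x))) := by
  refine (((h.hasACDeriv_fst.mul h.hasACDeriv_fst.star).sub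
    (h.hasACDeriv_snd.mul h.hasACDeriv_snd.star)).mul ((h.hasACDeriv_dotProduct_star h).inv
    fun x => dotProduct_star_self_ne_zero (hΨ₀ x))).of_eq_deriv fun x => ?_
  have hx := dotProduct_star_self_ne_zero (hΨ₀ x)
  have hconj : conj (Ψ x ⬝ᵥ star (Ψ x)) = Ψ x ⬝ᵥ star (Ψ x) := by
    rw [dotProduct_star_self_eq, Complex.conj_ofReal]
  simp only [crossRatio, map_add, map_sub, map_mul, map_neg, map_inv₀, Complex.conj_conj, hconj]
  field_simp
  rw [dotProduct_star_eq]
  ring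

theorem memH_crossRatio (h : IsLaxSolution η Q Ψ) (hΨ₀ : ∀ x, Ψ x ≠ 0)
    (hratio : MemLp (fun x => crossRatio (Ψ x)) 2) {n : ℕ} (hQ : MemH n Q) :
    MemH (n + 1) fun x => crossRatio (Ψ x) := by
  have hcross := (h.hasACDeriv_crossRatio hΨ₀).hasWeakDeriv
  have hdiff := (h.hasACDeriv_diffRatio hΨ₀).hasWeakDeriv
  have hdiff_le : ∀ᵐ x, ‖diffRatio (Ψ x)‖ ≤ 1 := .of_forall fun x => norm_diffRatio_le (Ψ x)
  induction n with
  | zero =>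
    have hsource : MemLp (fun x => Q x + (η + conj η) * crossRatio (Ψ x)) 2 :=
      MemLp.add hQ (hratio.const_mul _)
    exact ⟨hratio, _, hcross, (hratio.const_mul _).add
      ((memLp_bounded_mul hdiff.locallyIntegrable.aestronglyMeasurable hdiff_le
        hsource).const_mul _)⟩
  | succ n ih =>
    have hcross_n := ih hQ.of_succ
    have hsource : MemH (n + 1) fun x => Q x + (η + conj η) * crossRatio (Ψ x) :=
      hQ.add (hcross_n.const_mul _)
    have hdiff' := ((hcross_n.star.mul le_rfl hsource).add
      (hcross_n.mul le_rfl hsource.star)).const_mul 2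
    exact ⟨hratio, _, hcross, (hcross_n.const_mul _).add
      ((MemH.mul_of_bounded hdiff hdiff_le hdiff' (Nat.le_succ _) hsource).const_mul _)⟩

theorem memH_backlundTransform (h : IsLaxSolution η Q Ψ) (hΨ₀ : ∀ x, Ψ x ≠ 0)
    (hratio : MemLp (fun x => crossRatio (Ψ x)) 2) (k : ℝ) {n : ℕ} (hQ : MemH n Q) :
    MemH n (backlundTransform k Q Ψ) := by
  rw [funext (backlundTransform_eq k Q Ψ)]
  exact (hQ.const_mul _).add ((h.memH_crossRatio hΨ₀ hratio hQ).of_succ.const_mul _)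

theorem isLaxEigenvector {B : ℝ} (h : IsLaxSolution η Q Ψ) (hQ : MemLp Q 2) (hΨ : MemLp Ψ 2)
    (hΨB : ∀ x, ‖Ψ x‖ ≤ B) (hΨ₀ : ∀ x, Ψ x ≠ 0) : IsLaxEigenvector η Q Ψ where
  memH := by
    refine ⟨hΨ, _, h.hasWeakDeriv, ((hΨ.norm.const_mul ‖η‖).add (hQ.norm.const_mul B)).mono'
      h.locallyIntegrable.aestronglyMeasurable (.of_forall fun x => ?_)⟩
    have hcoord := norm_le_pi_norm (Ψ x)
    have hQΨ : ∀ i, ‖Q x‖ * ‖Ψ x i‖ ≤ B * ‖Q x‖ := fun i => by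
      rw [mul_comm]
      exact mul_le_mul_of_nonneg_right ((hcoord i).trans (hΨB x)) (norm_nonneg _)
    have hηΨ : ∀ i, ‖η‖ * ‖Ψ x i‖ ≤ ‖η‖ * ‖Ψ x‖ := fun i =>
      mul_le_mul_of_nonneg_left (hcoord i) (norm_nonneg _)
    have hB : 0 ≤ B := (norm_nonneg _).trans (hΨB x)
    change ‖laxMatrix η (Q x) *ᵥ Ψ x‖ ≤ ‖η‖ * ‖Ψ x‖ + B * ‖Q x‖
    refine (pi_norm_le_iff_of_nonneg (by positivity)).2 (Fin.forall_fin_two.2 ⟨?_, ?_⟩)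
    · rw [laxMatrix_mulVec_zero]
      refine (norm_add_le _ _).trans ?_
      rw [norm_mul, norm_mul]
      exact add_le_add (hηΨ 0) (hQΨ 1)
    · rw [laxMatrix_mulVec_one]
      refine (norm_sub_le _ _).trans ?_
      rw [norm_mul, norm_mul, norm_neg, RCLike.norm_conj, add_comm]
      exact add_le_add (hηΨ 1) (hQΨ 0)
  ne_zero hzero := by
    obtain ⟨x, hx⟩ := hzero.exists
    exact hΨ₀ x hx
  eqn := h.hasWeakDeriv

end IsLaxSolution

theorem IsLaxEigenvector.exists_ae_eq_smul (hΦ : IsLaxEigenvector η Q Φ) (hΨ : IsLaxSolution η Q Ψ)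
    (hΨ₂ : MemLp Ψ 2) (hΨ₀ : ∀ x, Ψ x ≠ 0) : ∃ l : ℂ, l ≠ 0 ∧ ∀ᵐ x, Φ x = l • Ψ x := by
  obtain ⟨F, hΦF, hF, hF₂⟩ := hΦ.exists_isLaxSolution
  obtain ⟨l, hl⟩ := hF.exists_eq_smul hΨ hF₂ hΨ₂ hΨ₀
  have hΦΨ : ∀ᵐ x, Φ x = l • Ψ x := by filter_upwards [hΦF] with x hx using hx.trans (hl x)
  refine ⟨l, fun hl₀ => hΦ.ne_zero ?_, hΦΨ⟩
  filter_upwards [hΦΨ] with x hx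
  rw [hx, hl₀, zero_smul, Pi.zero_apply]

end LaxSystem

section Amplitude

variable {p t : ℝ → ℂ} {μ : ℂ} {δ : ℝ}

/-- The correction, due to the slope `t` and the perturbation `p` of the potential, to the
logarithmic derivative of the amplitude of the eigenvector. -/
noncomputable def amplitudeRate (p t : ℝ → ℂ) (μ : ℂ) (x : ℝ) : ℂ :=
  -((p x).im * Complex.I * sech x) - t x * ((1 + μ) * sech x + imScale (-Real.tanh x) (p x))

theorem norm_amplitudeRate_le (x : ℝ) :
    ‖amplitudeRate p t μ x‖ ≤
      sech x * (‖t x‖ * (1 + ‖μ‖) + ‖p x‖) + (‖t x‖ ^ 2 + ‖p x‖ ^ 2) / 2 := by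
  have hμ : ‖1 + μ‖ ≤ 1 + ‖μ‖ := (norm_add_le _ _).trans (by rw [norm_one])
  have hquad : ‖(1 + μ) * sech x + imScale (-Real.tanh x) (p x)‖ ≤
      (1 + ‖μ‖) * sech x + ‖p x‖ := by
    refine (norm_add_le _ _).trans
      (add_le_add ?_ (norm_imScale_le (by rw [abs_neg]; exact (Real.abs_tanh_lt_one x).le)))
    rw [mul_comm, norm_sech_mul, mul_comm]
    exact mul_le_mul_of_nonneg_right hμ (sech_pos x).le
  have him : ‖((p x).im * Complex.I * sech x : ℂ)‖ ≤ sech x * ‖p x‖ := by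
    rw [mul_comm, norm_sech_mul]
    exact mul_le_mul_of_nonneg_left norm_im_mul_I_le (sech_pos x).le
  calc ‖amplitudeRate p t μ x‖
      ≤ sech x * ‖p x‖ + ‖t x‖ * ((1 + ‖μ‖) * sech x + ‖p x‖) := by
        refine (norm_sub_le _ _).trans (add_le_add ?_ ?_)
        · rwa [norm_neg]
        · rw [norm_mul]
          gcongr
    _ ≤ _ := by nlinarith [sq_nonneg (‖t x‖ - ‖p x‖)]

theorem aestronglyMeasurable_amplitudeRate (hp : AEStronglyMeasurable p) (ht : Continuous t)
    (μ : ℂ) : AEStronglyMeasurable (amplitudeRate p t μ) := by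
  have hcont : Continuous fun z : ℝ × ℂ => -(z.2.im * Complex.I * sech z.1) -
      t z.1 * ((1 + μ) * sech z.1 + imScale (-Real.tanh z.1) z.2) := by
    unfold imScale
    fun_prop
  have hpair : AEStronglyMeasurable fun x => (x, p x) := aestronglyMeasurable_id.prodMk hp
  exact (hcont.comp_aestronglyMeasurable hpair :)

theorem IsSmallRiccatiSolution.integrable_amplitudeRate_and_integral_norm_le
    (h : IsSmallRiccatiSolution p δ t μ) :
    Integrable (amplitudeRate p t μ) ∧ ∫ x, ‖amplitudeRate p t μ x‖ ≤ 15 * δ := by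
  obtain ⟨htsq, htsq_le⟩ := h.integrable_and_integral_le
  have hpsq : Integrable fun x => ‖p x‖ ^ 2 := h.memLp.integrable_norm_pow two_ne_zero
  have hkernel := integrable_exp_neg_abs_sub_mul h.memLp (6 * δ) 2 0
  have hkernel_le := integral_exp_neg_abs_sub_mul_le h.memLp h.nonneg h.integral_norm_sq_le
    zero_le_two (6 * δ) 0
  have hsquares := (htsq.add hpsq).div_const 2
  have hle : ∀ x, ‖amplitudeRate p t μ x‖ ≤
      Real.exp (-|0 - x|) * (6 * δ + 2 * ‖p x‖) + (‖t x‖ ^ 2 + ‖p x‖ ^ 2) / 2 := fun x => by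
    have hcoeff : ‖t x‖ * (1 + ‖μ‖) ≤ 2 * δ * (3 / 2) := by
      gcongr
      · linarith [h.nonneg]
      · exact h.norm_le x
      · linarith [h.norm_eigenvalue_le, h.le]
    calc _ ≤ 2 * Real.exp (-|x|) * (2 * δ * (3 / 2) + ‖p x‖) + (‖t x‖ ^ 2 + ‖p x‖ ^ 2) / 2 := by
          refine (norm_amplitudeRate_le x).trans ?_
          gcongr
          exact sech_le_two_mul_exp_neg_abs x
      _ = _ := by rw [zero_sub, abs_neg]; ring
  have hint : Integrable (amplitudeRate p t μ) := (hkernel.add hsquares).mono'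
    (aestronglyMeasurable_amplitudeRate h.memLp.1 h.hasACDeriv.continuous μ) (.of_forall hle)
  refine ⟨hint, (integral_mono hint.norm (hkernel.add hsquares) hle).trans ?_⟩
  rw [integral_add' hkernel hsquares]
  simp only [Pi.add_apply]
  rw [integral_div, integral_add htsq hpsq]
  nlinarith [h.nonneg, h.le, h.integral_norm_sq_le]

/-- The logarithm of the ratio of the amplitudes of the perturbed and of the soliton eigenvector. -/
noncomputable def amplitudeExponent (p t : ℝ → ℂ) (μ : ℂ) (x : ℝ) : ℂ :=
  -μ * Real.log (Real.cosh x) + ∫ y in 0..x, amplitudeRate p t μ y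

/-- The amplitude of the perturbed eigenvector. -/
noncomputable def amplitude (p t : ℝ → ℂ) (μ : ℂ) (x : ℝ) : ℂ :=
  2 * sechRoot x * Complex.exp (amplitudeExponent p t μ x)

theorem amplitude_ne_zero (p t : ℝ → ℂ) (μ : ℂ) (x : ℝ) : amplitude p t μ x ≠ 0 :=
  mul_ne_zero (mul_ne_zero two_ne_zero (Complex.ofReal_ne_zero.2 (sechRoot_pos x).ne'))
    (Complex.exp_ne_zero _)

theorem hasDerivAt_log_cosh (x : ℝ) :
    HasDerivAt (fun y => Real.log (Real.cosh y)) (Real.tanh x) x := by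
  rw [Real.tanh_eq_sinh_div_cosh]
  exact (Real.hasDerivAt_cosh x).log (Real.cosh_pos x).ne'

theorem log_cosh_le_abs (x : ℝ) : Real.log (Real.cosh x) ≤ |x| := by
  rw [Real.log_le_iff_le_exp (Real.cosh_pos x), ← Real.cosh_abs, Real.cosh_eq]
  linarith [Real.exp_le_exp.2 (neg_le_self (abs_nonneg x))]

theorem hasACDeriv_amplitude (hrate : Integrable (amplitudeRate p t μ)) :
    HasACDeriv (amplitude p t μ) fun x =>
      amplitude p t μ x * (-(1 / 2 + μ) * Real.tanh x + amplitudeRate p t μ x) := by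
  have hlog := (HasACDeriv.of_hasDerivAt hasDerivAt_log_cosh continuous_tanh).ofReal
  have hroot := (HasACDeriv.of_hasDerivAt hasDerivAt_sechRoot (by
    unfold sechRoot
    fun_prop)).ofReal
  exact ((hroot.const_mul 2).mul (((hlog.const_mul (-μ)).add
    (.of_locallyIntegrable hrate.locallyIntegrable 0)).cexp)).of_eq_deriv fun x => by
      rw [amplitude, amplitudeExponent]
      push_cast
      ring

theorem norm_amplitudeExponent_le (hrate : Integrable (amplitudeRate p t μ)) (x : ℝ) :
    ‖amplitudeExponent p t μ x‖ ≤ ‖μ‖ * |x| + ∫ y, ‖amplitudeRate p t μ y‖ := by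
  refine (norm_add_le _ _).trans (add_le_add ?_ ?_)
  · rw [norm_mul, norm_neg, Complex.norm_real,
      Real.norm_of_nonneg (Real.log_nonneg (Real.one_le_cosh x))]
    exact mul_le_mul_of_nonneg_left (log_cosh_le_abs x) (norm_nonneg μ)
  · exact intervalIntegral.norm_integral_le_integral_norm_uIoc.trans
      (setIntegral_le_integral hrate.norm (.of_forall fun _ => norm_nonneg _))

theorem norm_exp_sub_one_le (z : ℂ) : ‖Complex.exp z - 1‖ ≤ ‖z‖ * Real.exp ‖z‖ := by
  simpa using Complex.norm_exp_sub_sum_le_norm_mul_exp z 1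

theorem mul_exp_neg_div_four_le (x : ℝ) : x * Real.exp (-x / 4) ≤ 4 := by
  have hexp := Real.add_one_le_exp (x / 4)
  rw [neg_div, Real.exp_neg, ← div_eq_mul_inv, div_le_iff₀ (Real.exp_pos _)]
  linarith

namespace IsSmallRiccatiSolution

variable (h : IsSmallRiccatiSolution p δ t μ) (x : ℝ)

include h

theorem norm_amplitudeExponent_le :
    ‖amplitudeExponent p t μ x‖ ≤ δ * (2 * |x| + 15) := by
  obtain ⟨hrate, hrate_le⟩ := h.integrable_amplitudeRate_and_integral_norm_le
  have hμ := mul_le_mul_of_nonneg_right h.norm_eigenvalue_le (abs_nonneg x)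
  linarith [_root_.norm_amplitudeExponent_le hrate x]

theorem norm_amplitude_le : ‖amplitude p t μ x‖ ≤ 6 * Real.exp (-|x| / 4) := by
  have hexponent : ‖amplitudeExponent p t μ x‖ ≤ |x| / 4 + 1 := by
    nlinarith [h.norm_amplitudeExponent_le x, abs_nonneg x, h.le, h.nonneg]
  calc ‖amplitude p t μ x‖
      = 2 * sechRoot x * ‖Complex.exp (amplitudeExponent p t μ x)‖ := by
        simp [amplitude, abs_of_pos (sechRoot_pos x)]
    _ ≤ 2 * Real.exp (-|x| / 2) * Real.exp (|x| / 4 + 1) := by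
        gcongr
        · exact sechRoot_le x
        · exact (Complex.norm_exp_le_exp_norm _).trans (Real.exp_le_exp.2 hexponent)
    _ = 2 * Real.exp 1 * Real.exp (-|x| / 4) := by
        rw [mul_assoc, mul_assoc, ← Real.exp_add, ← Real.exp_add]
        ring_nf
    _ ≤ 6 * Real.exp (-|x| / 4) := by
        gcongr
        linarith [Real.exp_one_lt_three]

theorem norm_amplitude_sub_le : ‖amplitude p t μ x - 2 * sechRoot x‖ ≤ 138 * δ := by
  have hexponent : ‖amplitudeExponent p t μ x‖ ≤ |x| / 4 + 1 := by
    nlinarith [h.norm_amplitudeExponent_le x, abs_nonneg x, h.le, h.nonneg]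
  have hexp_le_one : Real.exp (-|x| / 4) ≤ 1 :=
    Real.exp_le_one_iff.2 (by linarith [abs_nonneg x])
  calc ‖amplitude p t μ x - 2 * sechRoot x‖
      = 2 * sechRoot x * ‖Complex.exp (amplitudeExponent p t μ x) - 1‖ := by
        rw [amplitude, ← mul_sub_one]
        simp [abs_of_pos (sechRoot_pos x)]
    _ ≤ 2 * Real.exp (-|x| / 2) * (δ * (2 * |x| + 15) * Real.exp (|x| / 4 + 1)) := by
        have hδ := h.nonneg
        gcongr
        · exact sechRoot_le x
        · refine (norm_exp_sub_one_le _).trans ?_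
          gcongr
          exact h.norm_amplitudeExponent_le x
    _ = 2 * δ * Real.exp 1 * (2 * (|x| * Real.exp (-|x| / 4)) + 15 * Real.exp (-|x| / 4)) := by
        have hsplit : Real.exp (-|x| / 2) * Real.exp (|x| / 4 + 1) =
            Real.exp 1 * Real.exp (-|x| / 4) := by
          rw [← Real.exp_add, ← Real.exp_add]
          ring_nf
        linear_combination 2 * δ * (2 * |x| + 15) * hsplit
    _ ≤ 2 * δ * 3 * (2 * 4 + 15 * 1) := by
        have hδ := h.nonneg
        gcongr
        · exact Real.exp_one_lt_three.le
        · exact mul_exp_neg_div_four_le |x|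
    _ = 138 * δ := by ring

end IsSmallRiccatiSolution

/-- The eigenvector of the perturbed problem, of slope `t` relative to the soliton eigenvector. -/
noncomputable def perturbedEigenvector (p t : ℝ → ℂ) (μ : ℂ) (x : ℝ) : Fin 2 → ℂ :=
  amplitude p t μ x • (solitonDirection x + t x • solitonNormal x)

namespace IsSmallRiccatiSolution

variable (h : IsSmallRiccatiSolution p δ t μ)

include h

theorem isLaxSolution :
    IsLaxSolution (1 / 2 + μ) (fun x => sech x + p x) (perturbedEigenvector p t μ) := by
  have hamplitude := hasACDeriv_amplitude h.integrable_amplitudeRate_and_integral_norm_le.1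
  have hdirection := hasACDeriv_solitonDirection.add (h.hasACDeriv.smul hasACDeriv_solitonNormal)
  refine (hamplitude.smul hdirection).of_eq_deriv fun x => ?_
  simp only [perturbedEigenvector, Matrix.mulVec_smul, Matrix.mulVec_add,
    laxMatrix_mulVec_solitonDirection, laxMatrix_mulVec_solitonNormal, riccatiSource, riccatiTerm,
    amplitudeRate]
  module

theorem norm_perturbedEigenvector_le (x : ℝ) :
    ‖perturbedEigenvector p t μ x‖ ≤ 12 * Real.exp (-|x| / 4) := by
  have hvector : ‖solitonDirection x + t x • solitonNormal x‖ ≤ 1 + 1 * 1 := by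
    refine (norm_add_le _ _).trans (add_le_add (norm_solitonDirection_le x) ?_)
    rw [norm_smul]
    gcongr
    · linarith [h.norm_le x, h.le]
    · exact norm_solitonNormal_le x
  rw [perturbedEigenvector, norm_smul]
  refine (mul_le_mul (h.norm_amplitude_le x) hvector (norm_nonneg _) (by positivity)).trans ?_
  linarith

theorem norm_perturbedEigenvector_sub_le (x : ℝ) :
    ‖perturbedEigenvector p t μ x - solitonEigenvector x‖ ≤ 150 * δ := by
  have hamplitude : ‖amplitude p t μ x‖ ≤ 6 := (h.norm_amplitude_le x).trans
    (mul_le_of_le_one_right (by norm_num) (Real.exp_le_one_iff.2 (by linarith [abs_nonneg x])))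
  have hsplit : perturbedEigenvector p t μ x - solitonEigenvector x =
      (amplitude p t μ x - 2 * sechRoot x) • solitonDirection x +
        (amplitude p t μ x * t x) • solitonNormal x := by
    rw [perturbedEigenvector, solitonEigenvector_eq_smul]
    module
  rw [hsplit]
  calc _ ≤ ‖amplitude p t μ x - 2 * sechRoot x‖ * ‖solitonDirection x‖ +
        ‖amplitude p t μ x‖ * ‖t x‖ * ‖solitonNormal x‖ := by
        refine (norm_add_le _ _).trans_eq ?_
        rw [norm_smul, norm_smul, norm_mul]
    _ ≤ 138 * δ * 1 + 6 * (2 * δ) * 1 := by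
        have hδ := h.nonneg
        gcongr
        exacts [h.norm_amplitude_sub_le x, norm_solitonDirection_le x, h.norm_le x,
          norm_solitonNormal_le x]
    _ = 150 * δ := by ring

end IsSmallRiccatiSolution

end Amplitude

section CrossRatio

variable (x : ℝ) (z : ℂ)

theorem dotProduct_star_solitonDirection_add :
    (solitonDirection x + z • solitonNormal x) ⬝ᵥ star (solitonDirection x + z • solitonNormal x) =
      ((1 + ‖z‖ ^ 2 : ℝ) : ℂ) := by
  have hunit : (frameCos x : ℂ) ^ 2 + (frameSin x : ℂ) ^ 2 = 1 := by
    exact_mod_cast frameCos_sq_add_frameSin_sq x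
  rw [dotProduct_star_eq, Complex.ofReal_add, Complex.ofReal_one, Complex.ofReal_pow,
    ← Complex.mul_conj']
  simp only [solitonDirection, solitonNormal, Pi.add_apply, Pi.smul_apply, smul_eq_mul,
    Matrix.cons_val_zero, Matrix.cons_val_one, map_add, map_mul, map_neg, Complex.conj_ofReal]
  linear_combination (1 + z * conj z) * hunit

theorem solitonDirection_add_ne_zero : solitonDirection x + z • solitonNormal x ≠ 0 := fun h => by
  have hnorm := dotProduct_star_solitonDirection_add x z
  rw [h, zero_dotProduct] at hnorm
  exact absurd (Complex.ofReal_eq_zero.1 hnorm.symm) (by positivity)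

theorem crossRatio_solitonDirection_add :
    crossRatio (solitonDirection x + z • solitonNormal x) + sech x / 2 =
      ((z * frameSin x ^ 2 - conj z * frameCos x ^ 2) + z * conj z * sech x) /
        (1 + ‖z‖ ^ 2 : ℝ) := by
  have hz : ((1 + ‖z‖ ^ 2 : ℝ) : ℂ) ≠ 0 := Complex.ofReal_ne_zero.2 (by positivity)
  rw [crossRatio, dotProduct_star_solitonDirection_add, ← div_eq_mul_inv, eq_div_iff hz, add_mul,
    div_mul_cancel₀ _ hz, ofReal_sech_eq, Complex.ofReal_add, Complex.ofReal_one,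
    Complex.ofReal_pow, ← Complex.mul_conj']
  simp only [solitonDirection, solitonNormal, Pi.add_apply, Pi.smul_apply, smul_eq_mul,
    Matrix.cons_val_zero, Matrix.cons_val_one, map_add, map_mul, Complex.conj_ofReal]
  ring

theorem norm_crossRatio_solitonDirection_add_le :
    ‖crossRatio (solitonDirection x + z • solitonNormal x) + sech x / 2‖ ≤ 2 * ‖z‖ := by
  have hlinear : ‖z * frameSin x ^ 2 - conj z * frameCos x ^ 2‖ ≤ ‖z‖ := by
    refine (norm_sub_le _ _).trans_eq ?_
    rw [norm_mul, norm_mul, RCLike.norm_conj, norm_pow, norm_pow, Complex.norm_real,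
      Complex.norm_real, ← mul_add, Real.norm_eq_abs, Real.norm_eq_abs, sq_abs, sq_abs, add_comm,
      frameCos_sq_add_frameSin_sq, mul_one]
  have hquadratic : ‖z * conj z * sech x‖ ≤ ‖z‖ ^ 2 := by
    rw [mul_comm, norm_sech_mul, norm_mul, RCLike.norm_conj, ← sq]
    exact mul_le_of_le_one_left (sq_nonneg _) (sech_le_one x)
  rw [crossRatio_solitonDirection_add, norm_div, Complex.norm_real,
    Real.norm_of_nonneg (by positivity), div_le_iff₀ (by positivity)]
  refine (norm_add_le _ _).trans ((add_le_add hlinear hquadratic).trans ?_)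
  nlinarith [mul_nonneg (norm_nonneg z) (sq_nonneg (‖z‖ - 1)),
    mul_nonneg (norm_nonneg z) (sq_nonneg ‖z‖)]

end CrossRatio

theorem perturbedEigenvector_ne_zero (p t : ℝ → ℂ) (μ : ℂ) (x : ℝ) :
    perturbedEigenvector p t μ x ≠ 0 :=
  smul_ne_zero (amplitude_ne_zero p t μ x) (solitonDirection_add_ne_zero x (t x))

theorem norm_crossRatio_perturbedEigenvector_add_le (p t : ℝ → ℂ) (μ : ℂ) (x : ℝ) :
    ‖crossRatio (perturbedEigenvector p t μ x) + sech x / 2‖ ≤ 2 * ‖t x‖ := by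
  rw [perturbedEigenvector, crossRatio_smul (amplitude_ne_zero p t μ x)]
  exact norm_crossRatio_solitonDirection_add_le x (t x)

theorem memLp_exp_neg_abs_div_four : MemLp (fun x : ℝ => Real.exp (-|x| / 4)) 2 := by
  rw [memLp_two_iff_integrable_sq (by fun_prop)]
  refine (integrable_exp_neg_mul_abs_sub (a := 1 / 2) (by norm_num) 0).congr
    (.of_forall fun x => ?_)
  simp only [← Real.exp_nat_mul, zero_sub, abs_neg]
  push_cast
  ring_nf

theorem memLp_solitonProfile : MemLp solitonProfile 2 := memLp_sech.ofReal

theorem eLpNorm_two_eq {E : Type*} [NormedAddCommGroup E] {f : ℝ → E} (hf : MemLp f 2) :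
    eLpNorm f 2 volume = ENNReal.ofReal √(∫ x, ‖f x‖ ^ 2) := by
  rw [hf.eLpNorm_eq_integral_rpow_norm two_ne_zero ENNReal.ofNat_ne_top]
  simp [Real.sqrt_eq_rpow]

namespace IsSmallRiccatiSolution

variable {p t : ℝ → ℂ} {μ : ℂ} {δ : ℝ} (h : IsSmallRiccatiSolution p δ t μ)

include h

theorem memLp_potential : MemLp (fun x => sech x + p x) 2 := memLp_solitonProfile.add h.memLp

theorem memLp_perturbedEigenvector : MemLp (perturbedEigenvector p t μ) 2 :=
  (memLp_exp_neg_abs_div_four.const_mul 12).mono' h.isLaxSolution.continuous.aestronglyMeasurable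
    (.of_forall h.norm_perturbedEigenvector_le)

theorem isLaxEigenvector :
    IsLaxEigenvector (1 / 2 + μ) (fun x => sech x + p x) (perturbedEigenvector p t μ) :=
  h.isLaxSolution.isLaxEigenvector h.memLp_potential h.memLp_perturbedEigenvector
    (fun x => (h.norm_perturbedEigenvector_le x).trans (mul_le_of_le_one_right (by norm_num)
      (Real.exp_le_one_iff.2 (by linarith [abs_nonneg x]))))
    (perturbedEigenvector_ne_zero p t μ)

theorem memLp_crossRatio : MemLp (fun x => crossRatio (perturbedEigenvector p t μ x)) 2 := by
  have hcont : Continuous fun x => crossRatio (perturbedEigenvector p t μ x) :=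
    (h.isLaxSolution.hasACDeriv_crossRatio (perturbedEigenvector_ne_zero p t μ)).continuous
  have ht : MemLp t 2 := (memLp_two_iff_integrable_sq_norm
    h.hasACDeriv.continuous.aestronglyMeasurable).2 h.integrable_and_integral_le.1
  refine ((ht.norm.const_mul 2).add (memLp_sech.const_mul (1 / 2))).mono'
    hcont.aestronglyMeasurable (.of_forall fun x => ?_)
  have hsech : ‖(sech x / 2 : ℂ)‖ = 1 / 2 * sech x := by
    rw [div_eq_mul_inv, norm_sech_mul]
    norm_num [mul_comm]
  calc ‖crossRatio (perturbedEigenvector p t μ x)‖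
      ≤ ‖crossRatio (perturbedEigenvector p t μ x) + sech x / 2‖ + ‖(sech x / 2 : ℂ)‖ :=
        norm_le_add_norm_add _ _
    _ ≤ 2 * ‖t x‖ + 1 / 2 * sech x :=
        add_le_add (norm_crossRatio_perturbedEigenvector_add_le p t μ x) hsech.le

theorem norm_backlundTransform_le (x : ℝ) :
    ‖backlundTransform (1 + 2 * μ.re) (fun x => sech x + p x) (perturbedEigenvector p t μ) x‖ ≤
      ‖p x‖ + 4 * δ * sech x + 5 * ‖t x‖ := by
  have hre := (Complex.abs_re_le_norm μ).trans h.norm_eigenvalue_le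
  have hk : |2 * (1 + 2 * μ.re)| ≤ 5 / 2 := by
    have hle := h.le
    rw [abs_le] at hre ⊢
    constructor <;> linarith
  have hμ : |2 * μ.re| ≤ 4 * δ := by
    rw [abs_mul, abs_two]
    linarith
  have hsplit : backlundTransform (1 + 2 * μ.re) (fun x => sech x + p x)
      (perturbedEigenvector p t μ) x = -p x + sech x * ((2 * μ.re : ℝ) : ℂ) +
        -((2 * (1 + 2 * μ.re) : ℝ) : ℂ) *
          (crossRatio (perturbedEigenvector p t μ x) + sech x / 2) := by
    rw [backlundTransform_eq]
    push_cast
    ring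
  rw [hsplit]
  refine norm_add₃_le.trans ?_
  rw [norm_neg, norm_sech_mul, norm_mul, norm_neg, Complex.norm_real, Complex.norm_real,
    Real.norm_eq_abs, Real.norm_eq_abs]
  have hcross := mul_le_mul hk (norm_crossRatio_perturbedEigenvector_add_le p t μ x)
    (norm_nonneg _) (by norm_num)
  linarith [mul_le_mul_of_nonneg_left hμ (sech_pos x).le]

theorem integral_norm_sq_backlundTransform_le :
    ∫ x, ‖backlundTransform (1 + 2 * μ.re) (fun x => sech x + p x)
      (perturbedEigenvector p t μ) x‖ ^ 2 ≤ (200 * δ) ^ 2 := by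
  set q := backlundTransform (1 + 2 * μ.re) (fun x => sech x + p x) (perturbedEigenvector p t μ)
  have hq_le : ∀ x, ‖q x‖ ^ 2 ≤ 3 * ‖p x‖ ^ 2 + 48 * δ ^ 2 * sech x ^ 2 + 75 * ‖t x‖ ^ 2 :=
    fun x => by
      refine (pow_le_pow_left₀ (norm_nonneg _) (h.norm_backlundTransform_le x) 2).trans ?_
      nlinarith [sq_nonneg (‖p x‖ - 4 * δ * sech x), sq_nonneg (‖p x‖ - 5 * ‖t x‖),
        sq_nonneg (4 * δ * sech x - 5 * ‖t x‖)]
  obtain ⟨htsq, htsq_le⟩ := h.integrable_and_integral_le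
  have hpsq : Integrable fun x => 3 * ‖p x‖ ^ 2 :=
    (h.memLp.integrable_norm_pow two_ne_zero).const_mul 3
  have hsech : Integrable fun x => 48 * δ ^ 2 * sech x ^ 2 :=
    memLp_sech.integrable_sq.const_mul _
  have hsum : Integrable fun x => 3 * ‖p x‖ ^ 2 + 48 * δ ^ 2 * sech x ^ 2 := hpsq.add hsech
  calc ∫ x, ‖q x‖ ^ 2
      ≤ ∫ x, (3 * ‖p x‖ ^ 2 + 48 * δ ^ 2 * sech x ^ 2 + 75 * ‖t x‖ ^ 2) :=
        integral_mono_of_nonneg (.of_forall fun x => sq_nonneg _)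
          (hsum.add (htsq.const_mul 75)) (.of_forall hq_le)
    _ = 3 * (∫ x, ‖p x‖ ^ 2) + 48 * δ ^ 2 * (∫ x, sech x ^ 2) + 75 * ∫ x, ‖t x‖ ^ 2 := by
        rw [integral_add hsum (htsq.const_mul 75), integral_add hpsq hsech,
          integral_const_mul, integral_const_mul, integral_const_mul]
    _ ≤ 3 * δ ^ 2 + 48 * δ ^ 2 * 4 + 75 * (136 * δ ^ 2) := by
        gcongr
        exacts [h.integral_norm_sq_le, integral_sech_sq_le]
    _ ≤ (200 * δ) ^ 2 := by linarith [sq_nonneg δ]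

theorem memH_backlundTransform (k : ℝ) {n : ℕ} (hp : MemH n fun x => sech x + p x) :
    MemH n (backlundTransform k (fun x => sech x + p x) (perturbedEigenvector p t μ)) :=
  h.isLaxSolution.memH_backlundTransform (perturbedEigenvector_ne_zero p t μ) h.memLp_crossRatio k
    hp

theorem eLpNorm_backlundTransform_le :
    eLpNorm (backlundTransform (1 + 2 * μ.re) (fun x => sech x + p x)
      (perturbedEigenvector p t μ)) 2 volume ≤ ENNReal.ofReal (200 * δ) := by
  have hq := (h.memH_backlundTransform (1 + 2 * μ.re) (n := 0) h.memLp_potential).memLp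
  rw [eLpNorm_two_eq hq]
  have hδ := h.nonneg
  exact ENNReal.ofReal_le_ofReal
    (Real.sqrt_le_iff.2 ⟨by positivity, h.integral_norm_sq_backlundTransform_le⟩)

theorem enorm_add_enorm_add_eLpNorm_le :
    ‖1 + 2 * μ.re - 1‖ₑ + ‖2 * μ.im‖ₑ +
      eLpNorm (perturbedEigenvector p t μ - solitonEigenvector) ∞ volume ≤
        ENNReal.ofReal (200 * δ) := by
  have hδ := h.nonneg
  have henorm : ∀ r : ℝ, |r| ≤ ‖μ‖ → ‖2 * r‖ₑ ≤ ENNReal.ofReal (4 * δ) := fun r hr => by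
    rw [← ofReal_norm, norm_mul, Real.norm_eq_abs, Real.norm_eq_abs, abs_two]
    exact ENNReal.ofReal_le_ofReal (by linarith [hr.trans h.norm_eigenvalue_le])
  have hsup : eLpNorm (perturbedEigenvector p t μ - solitonEigenvector) ∞ volume ≤
      ENNReal.ofReal (150 * δ) := by
    rw [eLpNorm_exponent_top]
    exact eLpNormEssSup_le_of_ae_bound (.of_forall h.norm_perturbedEigenvector_sub_le)
  rw [add_sub_cancel_left]
  calc _ ≤ ENNReal.ofReal (4 * δ) + ENNReal.ofReal (4 * δ) + ENNReal.ofReal (150 * δ) :=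
        add_le_add (add_le_add (henorm _ (Complex.abs_re_le_norm μ))
          (henorm _ (Complex.abs_im_le_norm μ))) hsup
    _ = ENNReal.ofReal (4 * δ + 4 * δ + 150 * δ) := by
        rw [← ENNReal.ofReal_add (by positivity) (by positivity),
          ← ENNReal.ofReal_add (by positivity) (by positivity)]
    _ ≤ ENNReal.ofReal (200 * δ) := ENNReal.ofReal_le_ofReal (by linarith)

theorem ae_ne_zero_and_backlundTransform_ae_eq {Φ : ℝ → Fin 2 → ℂ}
    (hΦ : IsLaxEigenvector (1 / 2 + μ) (fun x => sech x + p x) Φ) (k : ℝ) :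
    (∀ᵐ x, Φ x ≠ 0) ∧ backlundTransform k (fun x => sech x + p x) (perturbedEigenvector p t μ)
      =ᵐ[volume] backlundTransform k (fun x => sech x + p x) Φ := by
  obtain ⟨l, hl, hΦl⟩ := hΦ.exists_ae_eq_smul h.isLaxSolution h.memLp_perturbedEigenvector
    (perturbedEigenvector_ne_zero p t μ)
  constructor <;> filter_upwards [hΦl] with x hx
  · rw [hx]
    exact smul_ne_zero hl (perturbedEigenvector_ne_zero p t μ x)
  · rw [backlundTransform_eq, backlundTransform_eq, hx, crossRatio_smul hl]

end IsSmallRiccatiSolution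

theorem mainTheorem3_general :
    ∃ C ε : ℝ≥0, 0 < C ∧ 0 < ε ∧
      ∀ Q : ℝ → ℂ, MemLp Q 2 volume →
        eLpNorm (Q - solitonProfile) 2 volume ≤ ε →
        ∃ k v : ℝ,
          (∃ Ψ : ℝ → Fin 2 → ℂ,
            IsLaxEigenvector (((k : ℂ) + Complex.I * v) / 2) Q Ψ ∧
            ‖k - 1‖ₑ + ‖v‖ₑ + eLpNorm (Ψ - solitonEigenvector) ∞ volume
              ≤ C * eLpNorm (Q - solitonProfile) 2 volume) ∧
          ∀ Ψ : ℝ → Fin 2 → ℂ,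
            IsLaxEigenvector (((k : ℂ) + Complex.I * v) / 2) Q Ψ →
            (∀ᵐ x, Ψ x ≠ 0) ∧
            (∀ n, MemH n Q → MemH n (backlundTransform k Q Ψ)) ∧
            eLpNorm (backlundTransform k Q Ψ) 2 volume
              ≤ C * eLpNorm (Q - solitonProfile) 2 volume := by
  refine ⟨200, 1 / 200, by norm_num, by norm_num, fun Q hQ hε => ?_⟩
  obtain ⟨p, rfl⟩ : ∃ p : ℝ → ℂ, Q = fun x => sech x + p x :=
    ⟨Q - solitonProfile, funext fun x => (add_sub_cancel (solitonProfile x) (Q x)).symm⟩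
  have hpQ : (fun x => sech x + p x) - solitonProfile = p :=
    funext fun x => add_sub_cancel_left (solitonProfile x) (p x)
  have hp : MemLp p 2 := hpQ ▸ hQ.sub memLp_solitonProfile
  rw [hpQ, eLpNorm_two_eq hp] at hε ⊢
  set δ := √(∫ x, ‖p x‖ ^ 2)
  have hδ : δ ≤ 1 / 200 := by
    simpa using (ENNReal.ofReal_le_iff_le_toReal ENNReal.coe_ne_top).1 hε
  have hC : ((200 : ℝ≥0) : ℝ≥0∞) * ENNReal.ofReal δ = ENNReal.ofReal (200 * δ) := by
    simp [ENNReal.ofReal_mul]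
  obtain ⟨t, μ, h⟩ := exists_isSmallRiccatiSolution hp (Real.sqrt_nonneg _) hδ
    (Real.sq_sqrt (integral_nonneg fun x => sq_nonneg _)).ge
  have hη : (((1 + 2 * μ.re : ℝ) : ℂ) + Complex.I * ((2 * μ.im : ℝ) : ℂ)) / 2 = 1 / 2 + μ :=
    Complex.ext (by simp; ring) (by simp)
  refine ⟨1 + 2 * μ.re, 2 * μ.im, ?_⟩
  rw [hη, hC]
  refine ⟨⟨_, h.isLaxEigenvector, h.enorm_add_enorm_add_eLpNorm_le⟩, fun Φ hΦ => ?_⟩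
  obtain ⟨hΦ₀, hback⟩ := h.ae_ne_zero_and_backlundTransform_ae_eq hΦ (1 + 2 * μ.re)
  exact ⟨hΦ₀, fun n hn => (h.memH_backlundTransform _ hn).congr hback,
    (eLpNorm_congr_ae hback).symm.trans_le h.eLpNorm_backlundTransform_le⟩

theorem mainTheorem3 :
    ∃ C ε : ℝ≥0, 0 < C ∧ 0 < ε ∧
      ∀ Q : ℝ → ℂ, MemLp Q 2 volume →
        eLpNorm (Q - solitonProfile) 2 volume ≤ ε →
        ∃ k v : ℝ,
          (∃ Ψ : ℝ → Fin 2 → ℂ,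
            IsLaxEigenvector (((k : ℂ) + Complex.I * v) / 2) Q Ψ ∧
            ‖k - 1‖ₑ + ‖v‖ₑ + eLpNorm (Ψ - solitonEigenvector) ∞ volume
              ≤ C * eLpNorm (Q - solitonProfile) 2 volume) ∧
          (MemH 3 Q →
            ∀ Ψ : ℝ → Fin 2 → ℂ,
              IsLaxEigenvector (((k : ℂ) + Complex.I * v) / 2) Q Ψ →
              (∀ᵐ x, Ψ x ≠ 0) ∧
              MemH 3 (backlundTransform k Q Ψ) ∧
              eLpNorm (backlundTransform k Q Ψ) 2 volume
                ≤ C * eLpNorm (Q - solitonProfile) 2 volume) := by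
  obtain ⟨C, ε, hC, hε, h⟩ := mainTheorem3_general
  exact ⟨C, ε, hC, hε, fun Q hQ hQε => (h Q hQ hQε).imp fun k => .imp fun v hkv =>
    ⟨hkv.1, fun hQ₃ Ψ hΨ => (hkv.2 Ψ hΨ).imp_right (.imp_left fun hback => hback 3 hQ₃)⟩⟩
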